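/- Let $\mathfrak g$ be a finite-dimensional complex simple Lie algebra, $\mathfrak h$ a Cartan subalgebra, $\Delta$ the root system of $(\mathfrak g,\mathfrak h)$, $V$ the real span of $\Delta$, $\Pi=\{\alpha_1,\dots,\alpha_n\}$ a set of simple roots, $\Delta^+$ the corresponding set of positive roots, $\theta$ the highest root, and $\mathfrak b=\mathfrak h\oplus\bigoplus_{\gamma\in\Delta^+}\mathfrak g_\gamma$ the corresponding Borel subalgebra. Let $\mathrm{Ab}(\mathfrak g)$ be the set of abelian ideals of $\mathfrak b$; an abelian ideal is identified with the set $I\subset\Delta^+$ of those positive roots whose root spaces it contains. Let $2^\Pi$ be the set of all subsets of $\Pi$. Fix a Weyl-group-invariant inner product $(\ ,\ )$ on $V$, put $\mu^\vee=2\mu/(\mu,\mu)$ for $\mu\in\Delta$ and $Q^\vee=\bigoplus_{i=1}^n\mathbb Z\alpha_i^\vee\subset V$. Extend $(\ ,\ )$ to a symmetric bilinear form on $\widehat V=V\oplus\mathbb R\delta\oplus\mathbb R\lambda$ by $(\delta,V)=(\lambda,V)=(\delta,\delta)=(\lambda,\lambda)=0$ and $(\delta,\lambda)=1$. Put $\alpha_0=\delta-\theta$,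 let $s_i(x)=x-\frac{2(x,\alpha_i)}{(\alpha_i,\alpha_i)}\alpha_i$ on $\widehat V$ for $i=0,\dots,n$, and let the affine Weyl group $\widehat W$ be the subgroup of $GL(\widehat V)$ generated by $s_0,\dots,s_n$. Let $\widehat\Delta^+=\Delta^+\cup\{\gamma+k\delta\mid\gamma\in\Delta,\ k\ge1\}$ and, for $w\in\widehat W$, let $\mathcal N(w)=\{\nu\in\widehat\Delta^+\mid w(\nu)\in-\widehat\Delta^+\}$. Then: 1. For every $I\in\mathrm{Ab}(\mathfrak g)$ there is a unique $w_I\in\widehat W$ with $\mathcal N(w_I)=\{\delta-\gamma\mid\gamma\in I\}$. 2. For every $w\in\widehat W$ there is a unique $z\in Q^\vee$ such that, for each $i=1,\dots,n$, one has $w^{-1}(\alpha_i)=\mu_i+k_i\delta$ with $\mu_i\in\Delta$, $k_i\in\mathbb Z$ and $(z,\alpha_i)=k_i$. For $w=w_I$ this element is denoted $z_I$. 3. Write $z_I=\sum_{i=1}^n m_i\alpha_i^\vee$ with $m_i\in\mathbb Z$ and set $S_I=\{\alpha_i\in\Pi\mid m_i\text{ is odd}\}$. The map $I\mapsto S_I$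 is a bijection from $\mathrm{Ab}(\mathfrak g)$ onto $2^\Pi$. -/

import Mathlib

namespace AbIdeal

open LieAlgebra LieAlgebra.IsKilling

section RootSystem

variable {ι V N : Type*} [AddCommGroup V] [Module ℝ V] [AddCommGroup N] [Module ℝ N]
  {P : RootPairing ι ℝ V N}

/-- The space `V ⊕ ℝδ ⊕ ℝλ`; a triple `(v, a, c)` stands for `v + a δ + c λ`. -/
abbrev AffineSpace (V : Type*) : Type _ := V × ℝ × ℝ

/-- The inner product of `V` extended to `V ⊕ ℝδ ⊕ ℝλ`: the planes `V` and `ℝδ ⊕ ℝλ` are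
orthogonal, `δ` and `λ` are isotropic and `(δ, λ) = 1`. -/
def affineInner (B : P.InvariantForm) (x y : AffineSpace V) : ℝ :=
  B.form x.1 y.1 + x.2.1 * y.2.2 + x.2.2 * y.2.1

/-- The highest root: the root `θ` with `θ - γ` a non-negative integral combination of simple
roots for every root `γ`. -/
noncomputable def highestRoot (b : P.Base) : V :=
  Classical.epsilon fun θ ↦ θ ∈ Set.range P.root ∧
    ∀ i, θ - P.root i ∈ AddSubmonoid.closure (P.root '' b.support)

/-- The affine simple roots `α₁, …, αₙ` and `α₀ = δ - θ`. -/
def affineSimpleRoots (b : P.Base) : Set (AffineSpace V) :=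
  insert (-highestRoot b, 1, 0) {x | ∃ i ∈ b.support, x = (P.root i, 0, 0)}

/-- The positive affine real roots: `γ + kδ` with `k ≥ 1`, or with `k = 0` and `γ` positive. -/
def positiveAffineRoots (b : P.Base) : Set (AffineSpace V) :=
  {x | ∃ (i : ι) (k : ℤ), x = (P.root i, (k : ℝ), 0) ∧ (1 ≤ k ∨ (k = 0 ∧ b.IsPos i))}

/-- The affine Weyl group: the subgroup of `GL(V ⊕ ℝδ ⊕ ℝλ)` generated by the reflections
`x ↦ x - (x, a) a^∨`, `a^∨ = 2a / (a, a)`, in the affine simple roots `a`. -/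
def affineWeylGroup (b : P.Base) (B : P.InvariantForm) :
    Subgroup (AffineSpace V ≃ₗ[ℝ] AffineSpace V) :=
  Subgroup.closure {s | ∃ a ∈ affineSimpleRoots b,
    ∀ x, s x = x - affineInner B x a • (2 / affineInner B a a) • a}

/-- The positive affine roots that `w` makes negative. -/
def inversionSet (b : P.Base) (w : AffineSpace V ≃ₗ[ℝ] AffineSpace V) : Set (AffineSpace V) :=
  {ν | ν ∈ positiveAffineRoots b ∧ -(w ν) ∈ positiveAffineRoots b}

/-- `w` is minuscule with associated set of roots `I`: its inversion set is
`{δ - γ | γ ∈ I}`. -/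
def IsMinusculeWith (b : P.Base) (w : AffineSpace V ≃ₗ[ℝ] AffineSpace V) (I : Set ι) : Prop :=
  inversionSet b w = (fun i ↦ ((-P.root i, 1, 0) : AffineSpace V)) '' I

/-- The minuscule element `w_I` of the affine Weyl group attached to `I`. -/
noncomputable def minusculeElement (b : P.Base) (B : P.InvariantForm) (I : Set ι) :
    affineWeylGroup b B :=
  Classical.epsilon fun w ↦ IsMinusculeWith b (w : AffineSpace V ≃ₗ[ℝ] AffineSpace V) I

/-- The coroot `2α / (α, α)`, as an element of `V`. -/
noncomputable def corootVec (B : P.InvariantForm) (i : ι) : V :=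
  (2 / B.form (P.root i) (P.root i)) • P.root i

/-- The coroot lattice, spanned over `ℤ` by the simple coroots. -/
def corootLattice (b : P.Base) (B : P.InvariantForm) : AddSubgroup V :=
  AddSubgroup.closure (corootVec B '' b.support)

/-- `z` is the element of the coroot lattice attached to `w`: for every simple root `α`, one has
`w⁻¹(α) = μ + kδ` with `μ` a root and `k = (z, α)`. -/
def IsLatticeElementOf (b : P.Base) (B : P.InvariantForm)
    (w : AffineSpace V ≃ₗ[ℝ] AffineSpace V) (z : V) : Prop :=
  z ∈ corootLattice b B ∧ ∀ i ∈ b.support, ∃ (j : ι) (k : ℤ),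
    w⁻¹ (P.root i, 0, 0) = (P.root j, (k : ℝ), 0) ∧ B.form z (P.root i) = k

/-- The element `z_I` of the coroot lattice attached to `w_I`. -/
noncomputable def latticeElement (b : P.Base) (B : P.InvariantForm) (I : Set ι) : V :=
  Classical.epsilon (IsLatticeElementOf b B (minusculeElement b B I))

/-- The set of the simple roots whose coroot has odd coefficient in `z`. -/
def oddSimpleRoots (b : P.Base) (B : P.InvariantForm) (z : V) : Set b.support :=
  {i | ∃ m : b.support → ℤ, z = ∑ j, m j • corootVec B (j : ι) ∧ Odd (m i)}

end RootSystem

section LieAlgebra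

variable {𝔤 : Type*} [LieRing 𝔤] [LieAlgebra ℂ 𝔤] [FiniteDimensional ℂ 𝔤]
  [LieAlgebra.IsSimple ℂ 𝔤] (H : LieSubalgebra ℂ 𝔤) [H.IsCartanSubalgebra]

/-- The root system of `𝔤` relative to `H`, in the real span of the roots. -/
noncomputable abbrev realRootSystem :
    RootPairing H.root ℝ ((rootSystem H).rootSpan ℝ) ((rootSystem H).corootSpan ℝ) :=
  (rootSystem H).restrictScalars ℝ

variable {H}

/-- The sum of `H` and of the positive root spaces is closed under the bracket. -/
theorem borel_lie_mem (b : (realRootSystem H).Base) {x y : 𝔤}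
    (hx : x ∈ H.toSubmodule ⊔ ⨆ (i : H.root) (_ : b.IsPos i), (rootSpace H i.1).toSubmodule)
    (hy : y ∈ H.toSubmodule ⊔ ⨆ (i : H.root) (_ : b.IsPos i), (rootSpace H i.1).toSubmodule) :
    ⁅x, y⁆ ∈ H.toSubmodule ⊔ ⨆ (i : H.root) (_ : b.IsPos i), (rootSpace H i.1).toSubmodule := by
  set S := H.toSubmodule ⊔ ⨆ (i : H.root) (_ : b.IsPos i), (rootSpace H i.1).toSubmodule with hS
  let U : Set 𝔤 := (H : Set 𝔤) ∪ ⋃ (i : H.root) (_ : b.IsPos i), (rootSpace H i.1 : Set 𝔤)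
  have hroot : ∀ i : H.root, b.IsPos i → ∀ z ∈ rootSpace H i.1, z ∈ S := fun i hi z hz ↦
    Submodule.mem_sup_right (Submodule.mem_iSup_of_mem i (Submodule.mem_iSup_of_mem hi hz))
  have hSU : S ≤ Submodule.span ℂ U := by
    refine sup_le (fun z hz ↦ Submodule.subset_span (Or.inl hz)) (iSup₂_le fun i hi z hz ↦ ?_)
    exact Submodule.subset_span (Or.inr (Set.mem_iUnion₂.mpr ⟨i, hi, hz⟩))
  have key : ∀ u ∈ U, ∀ v ∈ U, ⁅u, v⁆ ∈ S := by
    have h1 : ∀ u ∈ H, ∀ i : H.root, b.IsPos i → ∀ v ∈ rootSpace H i.1, ⁅u, v⁆ ∈ S :=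
      fun u hu i hi v hv ↦ hroot i hi _ ((rootSpace H i.1).lie_mem (x := (⟨u, hu⟩ : H)) hv)
    rintro u (hu | hu) v (hv | hv)
    · exact Submodule.mem_sup_left (H.lie_mem hu hv)
    · obtain ⟨i, hi, hv⟩ := Set.mem_iUnion₂.mp hv
      exact h1 u hu i hi v hv
    · obtain ⟨i, hi, hu⟩ := Set.mem_iUnion₂.mp hu
      rw [← lie_skew]
      exact S.neg_mem (h1 v hv i hi u hu)
    · obtain ⟨i, hi, hu⟩ := Set.mem_iUnion₂.mp hu
      obtain ⟨j, hj, hv⟩ := Set.mem_iUnion₂.mp hv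
      have huv : ⁅u, v⁆ ∈ rootSpace H ((i.1 : H → ℂ) + j.1) :=
        lie_mem_genWeightSpace_of_mem_genWeightSpace hu hv
      by_cases hbot : rootSpace H ((i.1 : H → ℂ) + j.1) = ⊥
      · rw [hbot, LieSubmodule.mem_bot] at huv
        rw [huv]
        exact S.zero_mem
      let χ : LieModule.Weight ℂ H 𝔤 := ⟨(i.1 : H → ℂ) + j.1, hbot⟩
      have hχ : χ.IsNonZero := by
        intro h0
        have h0 : (i.1 : H → ℂ) + j.1 = 0 := h0
        have hj' : (realRootSystem H).root ((realRootSystem H).reflectionPerm i i) =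
            (realRootSystem H).root j := by
          rw [RootPairing.root_reflectionPerm, RootPairing.reflection_apply_self,
            neg_eq_iff_add_eq_zero]
          exact Subtype.ext (LinearMap.ext fun x ↦ congrFun h0 x)
        have hij := (realRootSystem H).root.injective hj'
        have := b.height_reflectionPerm_self i
        rw [RootPairing.Base.isPos_iff] at hi hj
        rw [← hij] at hj
        change b.height ((realRootSystem H).reflectionPerm i i) = _ at this
        omega
      let k : H.root := ⟨χ, by simpa using hχ⟩
      have hk : (realRootSystem H).root k = (realRootSystem H).root i + (realRootSystem H).root j :=
        Subtype.ext (LinearMap.ext fun _ ↦ rfl)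
      exact hroot k (hi.add hj hk) _ huv
  refine Submodule.span_induction₂ (p := fun x y _ _ ↦ ⁅x, y⁆ ∈ S) (fun u v hu hv ↦ key u hu v hv)
    ?_ ?_ ?_ ?_ ?_ ?_ (hSU hx) (hSU hy)
  · intro; simp
  · intro; simp
  · intro _ _ _ _ _ _ h h'; rw [add_lie]; exact S.add_mem h h'
  · intro _ _ _ _ _ _ h h'; rw [lie_add]; exact S.add_mem h h'
  · intro _ _ _ _ _ h; rw [smul_lie]; exact S.smul_mem _ h
  · intro _ _ _ _ _ h; rw [lie_smul]; exact S.smul_mem _ h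

/-- The Borel subalgebra which is the sum of `H` and of the positive root spaces. -/
noncomputable def borel (b : (realRootSystem H).Base) : LieSubalgebra ℂ 𝔤 where
  toSubmodule := H.toSubmodule ⊔ ⨆ (i : H.root) (_ : b.IsPos i), (rootSpace H i.1).toSubmodule
  lie_mem' := borel_lie_mem b

/-- The abelian ideals of the Borel subalgebra. -/
abbrev Ab (b : (realRootSystem H).Base) : Type _ :=
  {I : LieIdeal ℂ (borel b) // IsLieAbelian I}

/-- The positive roots whose root space is contained in an ideal of the Borel subalgebra. -/
def rootsOf (b : (realRootSystem H).Base) (I : LieIdeal ℂ (borel b)) : Set H.root :=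
  {i | b.IsPos i ∧
    (rootSpace H i.1).toSubmodule ≤ I.toSubmodule.map (borel b).toSubmodule.subtype}

/-- The set `S_I` of simple roots attached to an abelian ideal `I`. -/
def oddSet (b : (realRootSystem H).Base) (B : (realRootSystem H).InvariantForm) (I : Ab b) :
    Set b.support :=
  oddSimpleRoots b B (latticeElement b B (rootsOf b I.1))

end LieAlgebra

end AbIdeal

/-! The theorem is a count of alcoves. On `V ⊕ ℝδ` the affine Weyl group acts as the semidirect
product of the Weyl group `W` and the translations by `Q^∨`, and `z_I` is the translation part of
`w_I⁻¹`. Let `A` be the fundamental alcove. The set `S_I` records the class of `z_I` modulo `2Q^∨`.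
The elements `w_I` are those with `w⁻¹A ⊆ 2A`, and the dilated alcove `2A` is a fundamental domain
for `W ⋉ 2Q^∨`. So each class of `Q^∨ / 2Q^∨` contains `z_I` for exactly one `I`.

The proof replaces points of alcoves by linear forms on the affine roots, and dilation by the map `γ
+ kδ ↦ γ + 2kδ`. An element `w` has all its inversions among the `δ - γ`, `γ` positive, exactly when
it keeps positive the double of every positive affine root. Doubling turns the action of `(u, q)`
into that of `(u, 2q)`. For existence (`exists_isMinusculeWith_isLatticeElementOf`), a translated
and doubled alcove form is moved into the fundamental chamber (`exists_mem_forall_pos`). For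
uniqueness (`IsMinusculeWith.eq_of_isLatticeElementOf`), `w⁻¹w'` is the double of a group element
that preserves positivity, and such an element is `1` (`eq_one_of_forall_pos`).

Two dictionaries complete the argument. An abelian ideal is the sum of its root spaces
(`idealSubmodule_eq_biSup`), so it is determined by a set of positive roots that is closed upwards
and contains no two roots whose sum is a root. Such a set is built up one root at a time, each step
being a multiplication by a simple reflection (`IsAbelianSet.exists_isMinusculeWith`). -/

namespace AbIdeal

open LieAlgebra LieAlgebra.IsKilling

/-! ### Heights, dominance and the highest root. -/

section FiniteRootSystem

variable {ι V N : Type*} [AddCommGroup V] [Module ℝ V] [AddCommGroup N] [Module ℝ N]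
  {P : RootPairing ι ℝ V N}

/-- The non-negative integral combinations of the simple roots. -/
abbrev posCone (b : P.Base) : AddSubmonoid V := AddSubmonoid.closure (P.root '' b.support)

theorem mem_posCone_iff (b : P.Base) {x : V} :
    x ∈ posCone b ↔ ∃ f : ι → ℕ, x = ∑ j ∈ b.support, f j • P.root j := by
  classical
  constructor
  · intro hx
    induction hx using AddSubmonoid.closure_induction with
    | mem x hx =>
      obtain ⟨i, hi, rfl⟩ := hx
      refine ⟨Pi.single i 1, ?_⟩
      rw [Finset.sum_eq_single_of_mem i hi]
      · simp
      · intro j _ hj; simp [hj]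
    | zero => exact ⟨0, by simp⟩
    | add x y _ _ hx hy =>
      obtain ⟨f, rfl⟩ := hx
      obtain ⟨g, rfl⟩ := hy
      exact ⟨f + g, by simp [add_smul, Finset.sum_add_distrib]⟩
  · rintro ⟨f, rfl⟩
    exact sum_mem fun j hj ↦ nsmul_mem (AddSubmonoid.subset_closure (Set.mem_image_of_mem _ hj)) _

theorem simple_mem_posCone (b : P.Base) {i : ι} (hi : i ∈ b.support) : P.root i ∈ posCone b :=
  AddSubmonoid.subset_closure ⟨i, hi, rfl⟩

/-- The linear functional which takes the value `1` on every simple root. -/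
noncomputable def heightForm [P.IsRootSystem] (b : P.Base) : V →ₗ[ℝ] ℝ :=
  b.toWeightBasis.constr ℝ fun _ ↦ (1 : ℝ)

theorem heightForm_simple [P.IsRootSystem] (b : P.Base) {i : ι} (hi : i ∈ b.support) :
    heightForm b (P.root i) = 1 := by
  have := b.toWeightBasis.constr_basis ℝ (fun _ ↦ (1 : ℝ)) ⟨i, hi⟩
  rwa [RootPairing.Base.toWeightBasis_apply] at this

theorem heightForm_root [P.IsRootSystem] (b : P.Base) (i : ι) :
    heightForm b (P.root i) = b.height i := by
  obtain ⟨f, -, -, hf⟩ := b.exists_root_eq_sum_int i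
  rw [RootPairing.Base.height_eq_sum hf, hf]
  simp only [map_sum, map_zsmul, Int.cast_sum]
  refine Finset.sum_congr rfl fun j hj ↦ ?_
  rw [heightForm_simple b hj]; simp

theorem exists_nat_heightForm [P.IsRootSystem] (b : P.Base) {x : V} (hx : x ∈ posCone b) :
    ∃ n : ℕ, heightForm b x = n ∧ (n = 0 → x = 0) := by
  obtain ⟨f, rfl⟩ := (mem_posCone_iff b).1 hx
  refine ⟨∑ j ∈ b.support, f j, ?_, ?_⟩
  · simp only [map_sum, map_nsmul, Nat.cast_sum]
    refine Finset.sum_congr rfl fun j hj ↦ ?_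
    rw [heightForm_simple b hj]; simp
  · intro h
    rw [Finset.sum_eq_zero_iff] at h
    exact Finset.sum_eq_zero fun j hj ↦ by simp [h j hj]

theorem heightForm_nonneg [P.IsRootSystem] (b : P.Base) {x : V} (hx : x ∈ posCone b) :
    0 ≤ heightForm b x := by
  obtain ⟨n, hn, -⟩ := exists_nat_heightForm b hx
  rw [hn]; positivity

theorem eq_zero_of_heightForm_nonpos [P.IsRootSystem] (b : P.Base) {x : V} (hx : x ∈ posCone b)
    (h : heightForm b x ≤ 0) : x = 0 := by
  obtain ⟨n, hn, h0⟩ := exists_nat_heightForm b hx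
  refine h0 ?_
  rw [hn] at h
  exact Nat.le_zero.1 (by exact_mod_cast h)

theorem isPos_iff_heightForm [P.IsRootSystem] (b : P.Base) (i : ι) :
    b.IsPos i ↔ 0 < heightForm b (P.root i) := by
  rw [heightForm_root, RootPairing.Base.isPos_iff]; simp

theorem isPos_iff_mem_posCone [P.IsRootSystem] (b : P.Base) (i : ι) :
    b.IsPos i ↔ P.root i ∈ posCone b := by
  constructor
  · intro h
    refine (b.root_mem_or_neg_mem i).resolve_right fun h' ↦ ?_
    have := heightForm_nonneg b h'
    rw [isPos_iff_heightForm] at h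
    rw [map_neg] at this
    linarith
  · intro h
    rw [RootPairing.Base.isPos_iff']
    have := heightForm_nonneg b h
    rw [heightForm_root] at this
    exact_mod_cast this

theorem neg_mem_posCone_of_not_isPos [P.IsRootSystem] (b : P.Base) {i : ι} (h : ¬ b.IsPos i) :
    -P.root i ∈ posCone b := by
  rw [isPos_iff_mem_posCone] at h
  exact (b.root_mem_or_neg_mem i).resolve_left h

variable (B : P.InvariantForm) (hB : ∀ x, x ≠ 0 → 0 < B.form x x)

theorem form_comm (x y : V) : B.form x y = B.form y x := by
  simpa using B.symm.eq x y

include hB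

/-- Expanding one argument of `(x, x) > 0` in simple roots produces a positive term; its coefficient
is at least `1`, so the simple root can be subtracted inside the cone. This drives the descents on
height. -/
theorem exists_simple_form_pos (b : P.Base) {x : V} (hx : x ∈ posCone b) (h0 : x ≠ 0) :
    ∃ j ∈ b.support, 0 < B.form x (P.root j) ∧ x - P.root j ∈ posCone b := by
  classical
  obtain ⟨f, hf⟩ := (mem_posCone_iff b).1 hx
  have h1 : 0 < ∑ j ∈ b.support, f j * B.form x (P.root j) := by
    have := hB x h0
    nth_rw 2 [hf] at this
    simpa [map_sum] using this
  obtain ⟨j, hj, hpos⟩ := Finset.exists_lt_of_sum_lt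
    (show ∑ j ∈ b.support, (0 : ℝ) < ∑ j ∈ b.support, f j * B.form x (P.root j) by simpa using h1)
  have hfj : f j ≠ 0 := by rintro h; simp [h] at hpos
  have hBj : 0 < B.form x (P.root j) := by
    by_contra! hle
    have : (f j : ℝ) * B.form x (P.root j) ≤ 0 :=
      mul_nonpos_of_nonneg_of_nonpos (by positivity) hle
    linarith
  refine ⟨j, hj, hBj, (mem_posCone_iff b).2 ⟨f - (Pi.single j 1 : ι → ℕ), ?_⟩⟩
  rw [hf, ← Finset.add_sum_erase _ _ hj, ← Finset.add_sum_erase _ _ hj]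
  have h2 : ∑ k ∈ b.support.erase j, (f - (Pi.single j 1 : ι → ℕ)) k • P.root k =
      ∑ k ∈ b.support.erase j, f k • P.root k := by
    refine Finset.sum_congr rfl fun k hk ↦ ?_
    simp [Finset.ne_of_mem_erase hk]
  rw [h2]
  obtain ⟨m, hm⟩ := Nat.exists_eq_succ_of_ne_zero hfj
  simp only [hm, Nat.succ_eq_add_one, add_smul, one_smul, Pi.sub_apply, Pi.single_eq_same,
    add_tsub_cancel_right]
  abel

theorem pairing_pos_iff (i j : ι) : 0 < P.pairing i j ↔ 0 < B.form (P.root i) (P.root j) := by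
  have h := B.two_mul_apply_root_root i j
  have hj := hB _ (P.ne_zero j)
  constructor
  · intro hp
    have := mul_pos hp hj
    linarith
  · intro hp
    by_contra! hle
    have := mul_nonpos_of_nonpos_of_nonneg hle hj.le
    linarith

variable [Finite ι] [P.IsCrystallographic]

theorem sub_mem_range_of_form_pos {i j : ι} (h : 0 < B.form (P.root i) (P.root j)) :
    P.root i - P.root j ∈ Set.range P.root ∨ P.root i - P.root j = 0 := by
  by_cases hij : i = j
  · right; simp [hij]
  left
  refine P.root_sub_root_mem_of_pairingIn_pos ?_ hij
  rw [← pairing_pos_iff B hB, ← P.algebraMap_pairingIn ℤ] at h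
  simpa using h

theorem add_mem_range_of_form_neg {i j : ι} (h : B.form (P.root i) (P.root j) < 0) :
    P.root i + P.root j ∈ Set.range P.root ∨ P.root i + P.root j = 0 := by
  have h' : 0 < B.form (P.root i) (P.root (P.reflectionPerm j j)) := by simpa using h
  simpa using sub_mem_range_of_form_pos B hB h'

omit hB [Finite ι] [P.IsCrystallographic] in
/-- A root which cannot be raised by a simple root. -/
def IsMaximalRoot (b : P.Base) (i : ι) : Prop :=
  ∀ k ∈ b.support, P.root i + P.root k ∉ Set.range P.root ∧ P.root i + P.root k ≠ 0

omit hB [Finite ι] [P.IsCrystallographic] in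
theorem exists_raise_of_not_isMaximalRoot {b : P.Base} {i : ι} (h : ¬ IsMaximalRoot b i) :
    ∃ k ∈ b.support, P.root i + P.root k ∈ Set.range P.root ∨ P.root i + P.root k = 0 := by
  by_contra! h'
  exact h h'

theorem IsMaximalRoot.form_nonneg {b : P.Base} {i : ι} (h : IsMaximalRoot b i) {k : ι}
    (hk : k ∈ b.support) : 0 ≤ B.form (P.root i) (P.root k) := by
  by_contra! hneg
  rcases add_mem_range_of_form_neg B hB hneg with h' | h'
  · exact (h k hk).1 h'
  · exact (h k hk).2 h'

theorem IsMaximalRoot.mem_posCone {b : P.Base} {i : ι} (h : IsMaximalRoot b i) :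
    P.root i ∈ posCone b := by
  refine (b.root_mem_or_neg_mem i).resolve_right fun h' ↦ ?_
  obtain ⟨j, hj, hpos, -⟩ := exists_simple_form_pos B hB b h' (by simpa using P.ne_zero i)
  have := h.form_nonneg B hB hj
  simp at hpos
  linarith

/-- Induction on the height of the difference. A simple root `α` positive on the difference is
positive on the upper root, since the maximal root is dominant. Subtracting `α` from the upper root
gives the maximal root by induction, which `α` would then raise. -/
theorem IsMaximalRoot.eq_of_sub_mem [P.IsRootSystem] {b : P.Base} {i : ι} (h : IsMaximalRoot b i)
    {j : ι} (hj : P.root j - P.root i ∈ posCone b) : j = i := by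
  obtain ⟨n, hn, -⟩ := exists_nat_heightForm b hj
  induction n generalizing j with
  | zero =>
    exact P.root.injective (sub_eq_zero.1 (eq_zero_of_heightForm_nonpos b hj (by simp [hn])))
  | succ n ih =>
    by_contra hne
    obtain ⟨k, hk, hpos, hmem⟩ := exists_simple_form_pos B hB b hj
      (sub_ne_zero.2 fun h' ↦ hne (P.root.injective h'))
    have h1 := h.form_nonneg B hB hk
    have h2 : 0 < B.form (P.root j) (P.root k) := by
      simp only [map_sub, LinearMap.sub_apply] at hpos
      linarith
    rcases sub_mem_range_of_form_pos B hB h2 with ⟨l, hl⟩ | h0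
    · have hl' : P.root l - P.root i = P.root j - P.root i - P.root k := by rw [hl]; abel
      have := ih (j := l) (by rwa [hl']) (by
        rw [hl', map_sub, hn, heightForm_simple b hk]; push_cast; ring)
      subst this
      exact (h k hk).1 ⟨j, by rw [hl]; abel⟩
    · have h3 : -P.root i ∈ posCone b := by
        have : P.root j - P.root i - P.root k = -P.root i := by
          rw [sub_eq_zero.1 h0]; abel
        rwa [this] at hmem
      have h4 := heightForm_nonneg b h3
      have h5 := (isPos_iff_heightForm b i).1
        ((isPos_iff_mem_posCone b i).2 (h.mem_posCone B hB))
      rw [map_neg] at h4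
      linarith

/-- Both roots are dominant, so orthogonality would make the second orthogonal to every simple root
occurring in the first. Those simple roots span an invariant subspace: dominance of the first root
forces the remaining simple roots to be orthogonal to it. By irreducibility it is all of `V`, and
the second root would be isotropic. -/
theorem IsMaximalRoot.form_pos [P.IsIrreducible] [P.IsRootSystem] [P.IsReduced]
    {b : P.Base} {i j : ι}
    (hi : IsMaximalRoot b i) (hj : IsMaximalRoot b j) :
    0 < B.form (P.root i) (P.root j) := by
  obtain ⟨f, hf⟩ := (mem_posCone_iff b).1 (hi.mem_posCone B hB)
  have hsum : B.form (P.root i) (P.root j) =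
      ∑ k ∈ b.support, f k * B.form (P.root j) (P.root k) := by
    rw [form_comm B, hf]; simp [map_sum]
  have hnn : ∀ k ∈ b.support, 0 ≤ f k * B.form (P.root j) (P.root k) := fun k hk ↦
    mul_nonneg (by positivity) (hj.form_nonneg B hB hk)
  refine lt_of_le_of_ne (by rw [hsum]; exact Finset.sum_nonneg hnn) fun h0 ↦ ?_
  rw [hsum, eq_comm, Finset.sum_eq_zero_iff_of_nonneg hnn] at h0
  let q : Submodule ℝ V := Submodule.span ℝ (P.root '' {k | k ∈ b.support ∧ f k ≠ 0})
  have hq : q = ⊤ := by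
    refine RootPairing.IsIrreducible.eq_top_of_invtSubmodule_reflection (P := P) q ?_ ?_
    · rw [← b.forall_mem_support_invtSubmodule_iff]
      intro l hl
      by_cases hfl : f l = 0
      · have horth : ∀ k ∈ b.support, f k ≠ 0 → P.pairing k l = 0 := by
          have h1 := hi.form_nonneg B hB hl
          have h2 : B.form (P.root i) (P.root l) =
              ∑ k ∈ b.support, f k * B.form (P.root k) (P.root l) := by
            rw [hf]; simp [map_sum]
          have h3 : ∀ k ∈ b.support, f k * B.form (P.root k) (P.root l) ≤ 0 := by
            intro k hk
            by_cases hkl : k = l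
            · subst hkl; simp [hfl]
            refine mul_nonpos_of_nonneg_of_nonpos (by positivity) ?_
            by_contra! hpos
            rw [← pairing_pos_iff B hB, ← P.algebraMap_pairingIn ℤ] at hpos
            have := b.pairingIn_le_zero_of_ne hkl hk hl
            simp at hpos
            omega
          have h4 : ∑ k ∈ b.support, f k * B.form (P.root k) (P.root l) = 0 :=
            le_antisymm (Finset.sum_nonpos h3) (h2 ▸ h1)
          rw [Finset.sum_eq_zero_iff_of_nonpos h3] at h4
          intro k hk hfk
          have := h4 k hk
          rw [← B.apply_root_root_zero_iff]
          simpa [hfk] using this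
        intro x hx
        have hfix : P.reflection l x = x := by
          have : q ≤ LinearMap.ker (P.coroot' l) := by
            refine Submodule.span_le.2 ?_
            rintro _ ⟨k, ⟨hk, hfk⟩, rfl⟩
            simpa using horth k hk hfk
          have hx0 : P.coroot' l x = 0 := this hx
          rw [RootPairing.reflection_apply, hx0]; simp
        change P.reflection l x ∈ q
        rwa [hfix]
      · intro x hx
        change P.reflection l x ∈ q
        rw [RootPairing.reflection_apply]
        exact q.sub_mem hx (q.smul_mem _ (Submodule.subset_span ⟨l, ⟨hl, hfl⟩, rfl⟩))
    · intro hbot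
      have : P.root i ∈ q := by
        rw [hf]
        refine q.sum_mem fun k hk ↦ ?_
        by_cases hfk : f k = 0
        · simp [hfk]
        · exact q.smul_of_tower_mem _ (Submodule.subset_span ⟨k, ⟨hk, hfk⟩, rfl⟩)
      rw [hbot] at this
      exact P.ne_zero i (by simpa using this)
  have hker : q ≤ LinearMap.ker (B.form (P.root j)) := by
    refine Submodule.span_le.2 ?_
    rintro _ ⟨k, ⟨hk, hfk⟩, rfl⟩
    simpa [hfk] using h0 k hk
  have : B.form (P.root j) (P.root j) = 0 := hker (hq ▸ Submodule.mem_top)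
  exact B.ne_zero j this

theorem IsMaximalRoot.unique [P.IsIrreducible] [P.IsRootSystem] [P.IsReduced] {b : P.Base} {i j : ι}
    (hi : IsMaximalRoot b i) (hj : IsMaximalRoot b j) : i = j := by
  rcases sub_mem_range_of_form_pos B hB (hi.form_pos B hB hj) with ⟨k, hk⟩ | h0
  · rcases b.root_mem_or_neg_mem k with h | h
    · rw [hk] at h; exact hj.eq_of_sub_mem B hB h
    · rw [hk, neg_sub] at h; exact (hi.eq_of_sub_mem B hB h).symm
  · exact P.root.injective (sub_eq_zero.1 h0)

omit hB [P.IsCrystallographic] in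
theorem exists_isMaximalRoot_sub_mem [P.IsRootSystem] (b : P.Base) (i : ι) :
    ∃ j, IsMaximalRoot b j ∧ P.root j - P.root i ∈ posCone b := by
  classical
  have hfin : {j | P.root j - P.root i ∈ posCone b}.Finite := Set.toFinite _
  obtain ⟨j, hj, hmax⟩ := hfin.exists_maximalFor (fun j ↦ b.height j) _ ⟨i, by simp⟩
  refine ⟨j, ?_, hj⟩
  by_contra hnot
  obtain ⟨k, hk, ⟨l, hl⟩ | h0⟩ := exists_raise_of_not_isMaximalRoot hnot
  · have h1 : l ∈ {j | P.root j - P.root i ∈ posCone b} := by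
      change P.root l - P.root i ∈ posCone b
      have : P.root l - P.root i = P.root j - P.root i + P.root k := by rw [hl]; abel
      rw [this]
      exact add_mem hj (simple_mem_posCone b hk)
    have h2 := b.height_add hl
    rw [b.height_one_of_mem_support hk] at h2
    have := hmax h1 (by simp; omega)
    simp at this
    omega
  -- Here the root of greatest height is `-α` for a simple root `α`, and `α` itself lies above it,
  -- contradicting the choice.
  · have h1 : k ∈ {j | P.root j - P.root i ∈ posCone b} := by
      change P.root k - P.root i ∈ posCone b
      have : P.root k - P.root i = (P.root j - P.root i) + P.root k + P.root k := by
        rw [eq_neg_of_add_eq_zero_left h0]; abel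
      rw [this]
      exact add_mem (add_mem hj (simple_mem_posCone b hk)) (simple_mem_posCone b hk)
    have h2 : b.height k = -b.height j := by
      have : heightForm b (P.root j + P.root k) = 0 := by rw [h0]; simp
      rw [map_add, heightForm_root, heightForm_root] at this
      have h3 : b.height j + b.height k = 0 := by exact_mod_cast this
      omega
    have h3 := b.height_one_of_mem_support hk
    have := hmax h1 (by simp; omega)
    simp at this
    omega

/-- The highest root, as an index. -/
theorem exists_highestRoot [Nonempty ι] [P.IsIrreducible] [P.IsRootSystem] [P.IsReduced]
    (b : P.Base) : ∃ t, highestRoot b = P.root t ∧ IsMaximalRoot b t ∧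
      ∀ i, P.root t - P.root i ∈ posCone b := by
  have hex : ∃ θ : V, θ ∈ Set.range P.root ∧ ∀ i, θ - P.root i ∈ posCone b := by
    obtain ⟨t, ht, -⟩ := exists_isMaximalRoot_sub_mem b (Classical.arbitrary ι)
    refine ⟨P.root t, ⟨t, rfl⟩, fun i ↦ ?_⟩
    obtain ⟨j, hj, hji⟩ := exists_isMaximalRoot_sub_mem b i
    rwa [ht.unique B hB hj]
  obtain ⟨⟨t, ht⟩, hle⟩ := Classical.epsilon_spec hex
  change P.root t = highestRoot b at ht
  change ∀ i, highestRoot b - P.root i ∈ posCone b at hle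
  rw [← ht] at hle
  refine ⟨t, ht.symm, ?_, hle⟩
  obtain ⟨j, hj, hjt⟩ := exists_isMaximalRoot_sub_mem b t
  suffices t = j by rwa [this]
  refine P.root.injective (sub_eq_zero.1 (eq_zero_of_heightForm_nonpos b (hle j) ?_))
  have := heightForm_nonneg b hjt
  rw [map_sub] at this ⊢
  linarith

theorem exists_raise_of_ne_highestRoot [Nonempty ι] [P.IsIrreducible] [P.IsRootSystem]
    [P.IsReduced] (b : P.Base) {i : ι} (hi : P.root i ≠ highestRoot b) :
    ∃ k ∈ b.support, P.root i + P.root k ∈ Set.range P.root ∨ P.root i + P.root k = 0 := by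
  refine exists_raise_of_not_isMaximalRoot fun h ↦ ?_
  obtain ⟨t, ht, hmax, -⟩ := exists_highestRoot B hB b
  exact hi (ht ▸ congrArg P.root (h.unique B hB hmax))

end FiniteRootSystem

/-! ### Affine roots, positivity and affine reflections. -/

section Affine

variable {ι V N : Type*} [AddCommGroup V] [Module ℝ V] [AddCommGroup N] [Module ℝ N]
  {P : RootPairing ι ℝ V N}

/-- The affine real roots. -/
def IsAffineRoot (P : RootPairing ι ℝ V N) (x : AffineSpace V) : Prop :=
  ∃ (i : ι) (k : ℤ), x = (P.root i, (k : ℝ), 0)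

theorem IsAffineRoot.neg {x : AffineSpace V} (hx : IsAffineRoot P x) : IsAffineRoot P (-x) := by
  obtain ⟨i, k, rfl⟩ := hx
  exact ⟨P.reflectionPerm i i, -k, by simp⟩

theorem isAffineRoot_of_pos {b : P.Base} {x : AffineSpace V} (hx : x ∈ positiveAffineRoots b) :
    IsAffineRoot P x := by
  obtain ⟨i, k, h, -⟩ := hx
  exact ⟨i, k, h⟩

/-- The linear form which cuts out an interior point of the fundamental alcove: it is positive
exactly on the positive affine roots. -/
noncomputable def alcoveForm [P.IsRootSystem] (b : P.Base) : AffineSpace V →ₗ[ℝ] ℝ :=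
  (heightForm b) ∘ₗ LinearMap.fst ℝ V (ℝ × ℝ) +
    -- This coefficient exceeds the absolute height of every root, so a non-zero level decides the
    -- sign.
    (1 + ∑ᶠ i, |heightForm b (P.root i)|) •
      (LinearMap.fst ℝ ℝ ℝ ∘ₗ LinearMap.snd ℝ V (ℝ × ℝ))

theorem alcoveForm_apply [P.IsRootSystem] (b : P.Base) (v : V) (a c : ℝ) :
    alcoveForm b (v, a, c) = heightForm b v + (1 + ∑ᶠ i, |heightForm b (P.root i)|) * a := by
  simp [alcoveForm]

theorem abs_heightForm_root_lt [P.IsRootSystem] [Finite ι] (b : P.Base) (i : ι) :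
    |heightForm b (P.root i)| < 1 + ∑ᶠ i, |heightForm b (P.root i)| := by
  have := single_le_finsum i (Set.toFinite (Function.support fun i ↦ |heightForm b (P.root i)|))
    (fun j ↦ abs_nonneg _)
  linarith

theorem alcoveForm_delta_pos [P.IsRootSystem] [Finite ι] [Nonempty ι] (b : P.Base) :
    0 < alcoveForm b (0, 1, 0) := by
  have := abs_heightForm_root_lt b (Classical.arbitrary ι)
  have h2 := abs_nonneg (heightForm b (P.root (Classical.arbitrary ι)))
  rw [alcoveForm_apply]
  simp only [map_zero, zero_add, mul_one]
  linarith

theorem mem_positiveAffineRoots_iff (b : P.Base) (i : ι) (k : ℤ) :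
    ((P.root i, (k : ℝ), 0) : AffineSpace V) ∈ positiveAffineRoots b ↔
      1 ≤ k ∨ (k = 0 ∧ b.IsPos i) := by
  constructor
  · rintro ⟨j, l, h, h'⟩
    simp only [Prod.mk.injEq, and_true] at h
    obtain rfl := P.root.injective h.1
    have : k = l := by exact_mod_cast h.2
    rwa [this]
  · intro h
    exact ⟨i, k, rfl, h⟩

variable [P.IsRootSystem] [Finite ι]

/-- Positivity becomes a linear inequality; additivity of positivity and the trichotomy for affine
roots follow at once. -/
theorem mem_positiveAffineRoots_iff_alcoveForm {b : P.Base} {x : AffineSpace V}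
    (hx : IsAffineRoot P x) : x ∈ positiveAffineRoots b ↔ 0 < alcoveForm b x := by
  obtain ⟨i, k, rfl⟩ := hx
  rw [mem_positiveAffineRoots_iff, isPos_iff_heightForm, alcoveForm_apply]
  have h := abs_lt.1 (abs_heightForm_root_lt b i)
  set M := 1 + ∑ᶠ i, |heightForm b (P.root i)|
  have hM : 0 < M := by linarith
  constructor
  · rintro (hk | ⟨rfl, hi⟩)
    · have : (1 : ℝ) ≤ k := by exact_mod_cast hk
      nlinarith
    · simpa using hi
  · intro hpos
    rcases lt_trichotomy k 0 with hk | rfl | hk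
    · have : (k : ℝ) ≤ -1 := by exact_mod_cast (show k ≤ -1 by omega)
      nlinarith
    · right; simpa using hpos
    · left; omega

theorem alcoveForm_ne_zero {b : P.Base} {x : AffineSpace V}
    (hx : IsAffineRoot P x) : alcoveForm b x ≠ 0 := by
  obtain ⟨i, k, rfl⟩ := hx
  rw [alcoveForm_apply]
  have h := abs_lt.1 (abs_heightForm_root_lt b i)
  set M := 1 + ∑ᶠ i, |heightForm b (P.root i)|
  have hM : 0 < M := by linarith
  rcases lt_trichotomy k 0 with hk | rfl | hk
  · have : (k : ℝ) ≤ -1 := by exact_mod_cast (show k ≤ -1 by omega)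
    nlinarith
  · rw [heightForm_root]
    simpa using b.height_ne_zero i
  · have : (1 : ℝ) ≤ k := by exact_mod_cast (show 1 ≤ k by omega)
    nlinarith

theorem neg_mem_positiveAffineRoots_iff {b : P.Base} {x : AffineSpace V}
    (hx : IsAffineRoot P x) : -x ∈ positiveAffineRoots b ↔ x ∉ positiveAffineRoots b := by
  rw [mem_positiveAffineRoots_iff_alcoveForm hx, mem_positiveAffineRoots_iff_alcoveForm hx.neg,
    map_neg, not_lt, neg_pos, le_iff_lt_or_eq]
  exact ⟨Or.inl, fun h ↦ h.resolve_right (alcoveForm_ne_zero hx)⟩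

theorem sum_mem_positiveAffineRoots {b : P.Base} {x y : AffineSpace V}
    (hx : x ∈ positiveAffineRoots b) (hy : y ∈ positiveAffineRoots b)
    (hxy : IsAffineRoot P (x + y)) : x + y ∈ positiveAffineRoots b := by
  rw [mem_positiveAffineRoots_iff_alcoveForm hxy, map_add]
  exact add_pos ((mem_positiveAffineRoots_iff_alcoveForm (isAffineRoot_of_pos hx)).1 hx)
    ((mem_positiveAffineRoots_iff_alcoveForm (isAffineRoot_of_pos hy)).1 hy)

section Reflections

omit [P.IsRootSystem] [Finite ι]

variable (B : P.InvariantForm)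

theorem affineInner_add_left (x y z : AffineSpace V) :
    affineInner B (x + y) z = affineInner B x z + affineInner B y z := by
  simp [affineInner]; ring

theorem affineInner_sub_left (x y z : AffineSpace V) :
    affineInner B (x - y) z = affineInner B x z - affineInner B y z := by
  simp [affineInner]; ring

theorem affineInner_smul_left (r : ℝ) (x z : AffineSpace V) :
    affineInner B (r • x) z = r * affineInner B x z := by
  simp [affineInner]; ring

theorem affineInner_comm (x y : AffineSpace V) : affineInner B x y = affineInner B y x := by
  simp only [affineInner, form_comm B x.1]; ring

theorem affineInner_sub_right (x y z : AffineSpace V) :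
    affineInner B z (x - y) = affineInner B z x - affineInner B z y := by
  simp only [affineInner_comm B z, affineInner_sub_left]

theorem affineInner_smul_right (r : ℝ) (x z : AffineSpace V) :
    affineInner B z (r • x) = r * affineInner B z x := by
  simp only [affineInner_comm B z, affineInner_smul_left]

theorem affineInner_self_ne_zero {x : AffineSpace V} (hx : IsAffineRoot P x) :
    affineInner B x x ≠ 0 := by
  obtain ⟨i, k, rfl⟩ := hx
  simp [affineInner, B.ne_zero i]

/-- `s` is the reflection in the vector `a`. -/
def IsAffineReflection (a : AffineSpace V) (s : AffineSpace V ≃ₗ[ℝ] AffineSpace V) : Prop :=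
  ∀ x, s x = x - affineInner B x a • (2 / affineInner B a a) • a

variable {B}

theorem IsAffineReflection.unique {a : AffineSpace V} {s s' : AffineSpace V ≃ₗ[ℝ] AffineSpace V}
    (h : IsAffineReflection B a s) (h' : IsAffineReflection B a s') : s = s' :=
  LinearEquiv.ext fun x ↦ by rw [h, h']

theorem IsAffineReflection.apply_self {a : AffineSpace V}
    {s : AffineSpace V ≃ₗ[ℝ] AffineSpace V}
    (h : IsAffineReflection B a s) (ha : affineInner B a a ≠ 0) : s a = -a := by
  rw [h, smul_smul, mul_div_cancel₀ _ ha, two_smul]; abel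

theorem IsAffineReflection.apply_apply {a : AffineSpace V}
    {s : AffineSpace V ≃ₗ[ℝ] AffineSpace V}
    (h : IsAffineReflection B a s) (ha : affineInner B a a ≠ 0) (x : AffineSpace V) :
    s (s x) = x := by
  rw [h x, map_sub, map_smul, map_smul, h.apply_self ha, h x]; simp

theorem IsAffineReflection.mul_self {a : AffineSpace V}
    {s : AffineSpace V ≃ₗ[ℝ] AffineSpace V}
    (h : IsAffineReflection B a s) (ha : affineInner B a a ≠ 0) : s * s = 1 :=
  LinearEquiv.ext fun x ↦ h.apply_apply ha x

theorem exists_isAffineReflection {a : AffineSpace V} (ha : affineInner B a a ≠ 0) :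
    ∃ s, IsAffineReflection B a s := by
  let φ : AffineSpace V →ₗ[ℝ] AffineSpace V :=
    { toFun := fun x ↦ x - affineInner B x a • (2 / affineInner B a a) • a
      map_add' := fun x y ↦ by rw [affineInner_add_left, add_smul]; abel
      map_smul' := fun r x ↦ by
        rw [affineInner_smul_left, mul_smul, RingHom.id_apply, smul_sub] }
  have hφ : ∀ x, φ x = x - affineInner B x a • (2 / affineInner B a a) • a := fun _ ↦ rfl
  have hinv : Function.Involutive φ := fun x ↦ by
    rw [hφ, hφ, affineInner_sub_left, affineInner_smul_left, affineInner_smul_left,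
      div_mul_cancel₀ _ ha, sub_sub, ← add_smul]
    have : affineInner B x a + (affineInner B x a - affineInner B x a * 2) = 0 := by ring
    rw [this, zero_smul, sub_zero]
  exact ⟨LinearEquiv.ofInvolutive φ hinv, fun x ↦ rfl⟩

/-- The linear automorphisms preserving the extended inner product. -/
def IsAffineIsometry (B : P.InvariantForm) (w : AffineSpace V ≃ₗ[ℝ] AffineSpace V) : Prop :=
  ∀ x y, affineInner B (w x) (w y) = affineInner B x y

theorem IsAffineReflection.isometry {a : AffineSpace V}
    {s : AffineSpace V ≃ₗ[ℝ] AffineSpace V}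
    (h : IsAffineReflection B a s) (ha : affineInner B a a ≠ 0) : IsAffineIsometry B s := by
  intro x y
  rw [h, h]
  simp only [affineInner_sub_left, affineInner_sub_right, affineInner_smul_left,
    affineInner_smul_right]
  rw [affineInner_comm B a y]
  field_simp
  ring

theorem IsAffineReflection.conj {a : AffineSpace V}
    {s w : AffineSpace V ≃ₗ[ℝ] AffineSpace V}
    (h : IsAffineReflection B a s) (hw : IsAffineIsometry B w) :
    IsAffineReflection B (w a) (w * s * w⁻¹) := by
  intro x
  obtain ⟨y, rfl⟩ := w.surjective x
  have h1 : w⁻¹ (w y) = y := w.symm_apply_apply y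
  rw [LinearEquiv.mul_apply, LinearEquiv.mul_apply, h1, h y, hw, hw, map_sub, map_smul, map_smul]

/-- Invariance under the reflection in `α`, applied to the pair `(v, α)`, gives `2(v, α) = ⟨v,
α^∨⟩(α, α)`. -/
theorem form_root_eq_coroot' (B : P.InvariantForm) (i : ι) (v : V) :
    B.form v (P.root i) * (2 / B.form (P.root i) (P.root i)) = P.coroot' i v := by
  have h := B.apply_reflection_reflection i v (P.root i)
  rw [RootPairing.reflection_apply, RootPairing.reflection_apply_self] at h
  simp only [map_sub, map_neg, LinearMap.sub_apply, map_smul, LinearMap.smul_apply,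
    smul_eq_mul] at h
  have := B.ne_zero i
  field_simp
  linarith

theorem IsAffineReflection.apply_level {i : ι} {k : ℤ}
    {s : AffineSpace V ≃ₗ[ℝ] AffineSpace V}
    (h : IsAffineReflection B (P.root i, (k : ℝ), 0) s) (v : V) (t : ℝ) :
    s (v, t, 0) = (P.reflection i v, t - P.coroot' i v * k, 0) := by
  rw [h, smul_smul]
  simp only [affineInner, mul_zero, add_zero, zero_mul]
  rw [form_root_eq_coroot', RootPairing.reflection_apply]
  ext <;> simp

theorem IsAffineReflection.apply_delta {i : ι} {k : ℤ}
    {s : AffineSpace V ≃ₗ[ℝ] AffineSpace V}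
    (h : IsAffineReflection B (P.root i, (k : ℝ), 0) s) : s (0, 1, 0) = (0, 1, 0) := by
  rw [h.apply_level]; simp

theorem IsAffineReflection.apply_root [P.IsCrystallographic] {i : ι} {k : ℤ}
    {s : AffineSpace V ≃ₗ[ℝ] AffineSpace V}
    (h : IsAffineReflection B (P.root i, (k : ℝ), 0) s) (j : ι) (l : ℤ) :
    s (P.root j, (l : ℝ), 0) =
      (P.root (P.reflectionPerm i j), ((l - P.pairingIn ℤ j i * k : ℤ) : ℝ), 0) := by
  rw [h.apply_level, RootPairing.root_coroot'_eq_pairing, ← P.algebraMap_pairingIn ℤ]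
  simp

theorem IsAffineReflection.isAffineRoot [P.IsCrystallographic] {a : AffineSpace V}
    {s : AffineSpace V ≃ₗ[ℝ] AffineSpace V} (ha : IsAffineRoot P a)
    (h : IsAffineReflection B a s) {x : AffineSpace V} (hx : IsAffineRoot P x) :
    IsAffineRoot P (s x) := by
  obtain ⟨i, k, rfl⟩ := ha
  obtain ⟨j, l, rfl⟩ := hx
  exact ⟨_, _, h.apply_root j l⟩

end Reflections

end Affine

/-! ### Simple affine roots and their reflections. -/

section AffineSimple

variable {ι V N : Type*} [AddCommGroup V] [Module ℝ V] [AddCommGroup N] [Module ℝ N]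
  {P : RootPairing ι ℝ V N} (B : P.InvariantForm) (hB : ∀ x, x ≠ 0 → 0 < B.form x x)

theorem simple_mem_affineSimpleRoots (b : P.Base) {i : ι} (hi : i ∈ b.support) :
    ((P.root i, 0, 0) : AffineSpace V) ∈ affineSimpleRoots b :=
  Set.mem_insert_of_mem _ ⟨i, hi, rfl⟩

theorem add_highestRoot_mem_posCone {b : P.Base} {t : ι}
    (ht : ∀ i, P.root t - P.root i ∈ posCone b) (i : ι) : P.root i + P.root t ∈ posCone b := by
  have := ht (P.reflectionPerm i i)
  simp only [RootPairing.root_reflectionPerm, RootPairing.reflection_apply_self,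
    sub_neg_eq_add] at this
  rwa [add_comm]

variable [Finite ι] [Nonempty ι] [P.IsCrystallographic] [P.IsReduced] [P.IsRootSystem]
  [P.IsIrreducible]

include hB

theorem affineSimpleRoots_subset (b : P.Base) :
    affineSimpleRoots b ⊆ positiveAffineRoots b := by
  rintro x (rfl | ⟨i, hi, rfl⟩)
  · obtain ⟨t, ht, -⟩ := exists_highestRoot B hB b
    exact ⟨P.reflectionPerm t t, 1, by simp [ht], Or.inl le_rfl⟩
  · exact ⟨i, 0, by simp, Or.inr ⟨rfl, b.isPos_of_mem_support hi⟩⟩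

theorem isAffineRoot_of_simple {b : P.Base} {a : AffineSpace V} (ha : a ∈ affineSimpleRoots b) :
    IsAffineRoot P a := isAffineRoot_of_pos (affineSimpleRoots_subset B hB b ha)

/-- The reflection in a simple affine root permutes the other positive affine roots. -/
theorem reflection_mem_positiveAffineRoots {b : P.Base} {a : AffineSpace V}
    (ha : a ∈ affineSimpleRoots b) {s : AffineSpace V ≃ₗ[ℝ] AffineSpace V}
    (hs : IsAffineReflection B a s) {x : AffineSpace V} (hx : x ∈ positiveAffineRoots b)
    (hxa : x ≠ a) : s x ∈ positiveAffineRoots b := by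
  obtain ⟨i, k, rfl, hk⟩ := hx
  rcases ha with rfl | ⟨j, hj, rfl⟩
  · obtain ⟨t, ht, hmax, hle⟩ := exists_highestRoot B hB b
    rw [ht] at hs hxa
    have hs' : IsAffineReflection B
        ((P.root (P.reflectionPerm t t), ((1 : ℤ) : ℝ), 0) : AffineSpace V) s := by
      simpa using hs
    rw [hs'.apply_root, mem_positiveAffineRoots_iff]
    -- With `p = ⟨γ, θ^∨⟩`, the reflection in `δ - θ` sends `γ + kδ` to `(γ - pθ) + (k + p)δ`. Only
    -- `p < 0` lowers the level.
    have hp : P.pairingIn ℤ i (P.reflectionPerm t t) = -P.pairingIn ℤ i t := by simp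
    rw [hp, isPos_iff_heightForm]
    set p := P.pairingIn ℤ i t with hpdef
    have hroot : P.root (P.reflectionPerm (P.reflectionPerm t t) i) =
        P.root i - (p : ℝ) • P.root t := by
      rw [RootPairing.root_reflectionPerm, RootPairing.reflection_apply,
        RootPairing.root_coroot'_eq_pairing, ← P.algebraMap_pairingIn ℤ, hp]
      simp
    have hθ : 1 ≤ heightForm b (P.root t) := by
      have h1 : b.IsPos t := (isPos_iff_mem_posCone b t).2 (hmax.mem_posCone B hB)
      rw [heightForm_root]
      exact_mod_cast h1
    -- That `γ - pθ` lies below `θ` gives `ht γ ≤ (1 + p) ht θ`, while `ht γ ≥ -ht θ`. Hence `p ≥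
    -- -2`, and `p = -2` forces `γ = -θ`, where the excluded root `δ - θ` matters.
    have h1 := heightForm_nonneg b (hle (P.reflectionPerm (P.reflectionPerm t t) i))
    have h2 := heightForm_nonneg b (add_highestRoot_mem_posCone hle i)
    have h3 := fun h ↦ eq_zero_of_heightForm_nonpos b (add_highestRoot_mem_posCone hle i) h
    rw [map_sub, hroot, map_sub, map_smul, smul_eq_mul] at h1
    rw [map_add] at h2 h3
    rw [hroot, map_sub, map_smul, smul_eq_mul]
    rw [isPos_iff_heightForm] at hk
    set θ := heightForm b (P.root t)
    set g := heightForm b (P.root i) with hg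
    have hg0 : g ≠ 0 := by rw [hg, heightForm_root]; exact_mod_cast b.height_ne_zero i
    have hp2 : -2 ≤ p := by
      by_contra! h
      have : (p : ℝ) ≤ -3 := by exact_mod_cast (show p ≤ -3 by omega)
      nlinarith
    rcases lt_or_ge p 0 with hneg | hnn
    · have hgneg : g < 0 := by
        have : (p : ℝ) ≤ -1 := by exact_mod_cast (show p ≤ -1 by omega)
        refine lt_of_le_of_ne ?_ hg0
        nlinarith
      have hk1 : 1 ≤ k := by
        rcases hk with hk | ⟨-, hk⟩
        · exact hk
        · linarith
      obtain hp | hp : p = -1 ∨ p = -2 := by omega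
      · rw [hp]
        rcases eq_or_lt_of_le hk1 with rfl | hk1
        · right
          refine ⟨by norm_num, ?_⟩
          push_cast
          have h0 : g + θ ≠ 0 := by
            intro h0
            have := heightForm_root b (P.reflectionPerm (P.reflectionPerm t t) i)
            rw [hroot, map_sub, map_smul, hp] at this
            have h4 : ((b.height (P.reflectionPerm (P.reflectionPerm t t) i) : ℤ) : ℝ) = 0 := by
              rw [← this, smul_eq_mul]; push_cast; linarith
            exact b.height_ne_zero _ (by exact_mod_cast h4)
          have := lt_of_le_of_ne h2 h0.symm
          linarith
        · left; omega
      · have h4 := h3 (by rw [hp] at h1; push_cast at h1; linarith)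
        have h5 : P.root i = -P.root t := eq_neg_of_add_eq_zero_left h4
        have hk2 : k ≠ 1 := by
          rintro rfl
          exact hxa (by simp [h5])
        have hgt : g = -θ := by rw [hg, h5, map_neg]
        rw [hp, hgt]
        rcases eq_or_lt_of_le (show 2 ≤ k by omega) with rfl | hk1
        · right
          refine ⟨by norm_num, by push_cast; linarith⟩
        · left; omega
    · rcases hk with hk | ⟨rfl, hk⟩
      · left; simp; omega
      · rcases eq_or_lt_of_le hnn with h0 | h0
        · right
          rw [← h0]
          simpa using hk
        · left; simp; omega
  · have hs' : IsAffineReflection B ((P.root j, ((0 : ℤ) : ℝ), 0) : AffineSpace V) s := by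
      simpa using hs
    rw [hs'.apply_root, mem_positiveAffineRoots_iff]
    rcases hk with hk | ⟨rfl, hk⟩
    · left; simpa using hk
    · right
      refine ⟨by simp, hk.reflectionPerm hj ?_⟩
      rintro rfl
      exact hxa (by simp)

/-- Positive affine roots are non-negative integral combinations of simple affine roots. -/
theorem mem_closure_affineSimpleRoots {b : P.Base} {x : AffineSpace V}
    (hx : x ∈ positiveAffineRoots b) : x ∈ AddSubmonoid.closure (affineSimpleRoots b) := by
  have hcone : ∀ v ∈ posCone b,
      ((v, 0, 0) : AffineSpace V) ∈ AddSubmonoid.closure (affineSimpleRoots b) := by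
    intro v hv
    induction hv using AddSubmonoid.closure_induction with
    | mem v hv =>
      obtain ⟨i, hi, rfl⟩ := hv
      exact AddSubmonoid.subset_closure (simple_mem_affineSimpleRoots b hi)
    | zero => exact zero_mem _
    | add v w _ _ hv hw => simpa using add_mem hv hw
  obtain ⟨i, k, rfl, hk | ⟨rfl, hi⟩⟩ := hx
  · obtain ⟨t, ht, hmax, hle⟩ := exists_highestRoot B hB b
    obtain ⟨n, rfl⟩ : ∃ n : ℕ, k = n + 1 := ⟨(k - 1).toNat, by omega⟩
    -- For `k = n + 1` one has `γ + kδ = (γ + kθ) + k(δ - θ)`, and `γ + kθ` is in the cone because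
    -- `γ + θ` is.
    have h1 : P.root i + (n + 1) • P.root t ∈ posCone b := by
      have : P.root i + (n + 1) • P.root t = (P.root i + P.root t) + n • P.root t := by
        rw [add_smul, one_smul]; abel
      rw [this]
      exact add_mem (add_highestRoot_mem_posCone hle i)
        (nsmul_mem (hmax.mem_posCone B hB) n)
    have h2 : ((P.root i, (((n : ℤ) + 1 : ℤ) : ℝ), 0) : AffineSpace V) =
        (P.root i + (n + 1) • P.root t, 0, 0) + (n + 1) • (-highestRoot b, 1, 0) := by
      rw [ht]; ext <;> simp
    rw [h2]
    exact add_mem (hcone _ h1)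
      (nsmul_mem (AddSubmonoid.subset_closure (Set.mem_insert _ _)) _)
  · simpa using hcone _ ((isPos_iff_mem_posCone b i).1 hi)

/-- A positive affine root which is not simple remains positive, real or imaginary, after
subtraction of a suitable simple affine root. -/
theorem exists_sub_simple_mem {b : P.Base} {x : AffineSpace V}
    (hx : x ∈ positiveAffineRoots b) (hxs : x ∉ affineSimpleRoots b) :
    ∃ a ∈ affineSimpleRoots b, x - a ∈ positiveAffineRoots b ∨
      ∃ k : ℤ, 1 ≤ k ∧ x - a = (0, (k : ℝ), 0) := by
  obtain ⟨i, k, rfl, hk⟩ := hx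
  obtain hk | ⟨rfl, hi⟩ := hk
  · by_cases hi : -P.root i = highestRoot b
    · obtain ⟨t, ht, -⟩ := exists_highestRoot B hB b
      refine ⟨_, Set.mem_insert _ _, Or.inr ⟨k - 1, ?_, ?_⟩⟩
      · have : k ≠ 1 := by
          rintro rfl
          exact hxs (Or.inl (by simp [← hi]))
        omega
      · rw [← hi]; simp
    -- Raising `-γ` by a simple root lowers `γ` by it at the same level `k ≥ 1`; the result is real,
    -- or is `kδ`.
    · have hi' : P.root (P.reflectionPerm i i) ≠ highestRoot b := by simpa using hi
      obtain ⟨j, hj, ⟨l, hl⟩ | h0⟩ := exists_raise_of_ne_highestRoot B hB b hi'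
      · refine ⟨_, simple_mem_affineSimpleRoots b hj, Or.inl
          ⟨P.reflectionPerm l l, k, ?_, Or.inl hk⟩⟩
        have : P.root (P.reflectionPerm l l) = P.root i - P.root j := by
          rw [RootPairing.root_reflectionPerm, RootPairing.reflection_apply_self, hl,
            RootPairing.root_reflectionPerm, RootPairing.reflection_apply_self]
          abel
        simp [this]
      · refine ⟨_, simple_mem_affineSimpleRoots b hj, Or.inr ⟨k, hk, ?_⟩⟩
        have : P.root j = P.root i := by
          rw [eq_neg_of_add_eq_zero_right h0]; simp
        simp [this]
  · obtain ⟨j, hj, hpos, hmem⟩ := exists_simple_form_pos B hB b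
      ((isPos_iff_mem_posCone b i).1 hi) (P.ne_zero i)
    refine ⟨_, simple_mem_affineSimpleRoots b hj, Or.inl ?_⟩
    rcases sub_mem_range_of_form_pos B hB hpos with ⟨l, hl⟩ | h0
    · refine ⟨l, 0, by simp [hl, Prod.ext_iff], Or.inr ⟨rfl, ?_⟩⟩
      rwa [isPos_iff_mem_posCone, hl]
    · refine absurd ?_ hxs
      rw [P.root.injective (sub_eq_zero.1 h0)]
      simpa using simple_mem_affineSimpleRoots b hj

end AffineSimple

/-! ### The affine Weyl group: exchange, freeness, transitivity on chambers. -/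

section AffineWeyl

variable {ι V N : Type*} [AddCommGroup V] [Module ℝ V] [AddCommGroup N] [Module ℝ N]
  {P : RootPairing ι ℝ V N} {B : P.InvariantForm}

/-- The reflections in the simple affine roots. -/
def simpleReflections (b : P.Base) (B : P.InvariantForm) :
    Set (AffineSpace V ≃ₗ[ℝ] AffineSpace V) :=
  {s | ∃ a ∈ affineSimpleRoots b, IsAffineReflection B a s}

theorem simpleReflections_subset (b : P.Base) (B : P.InvariantForm) :
    simpleReflections b B ⊆ affineWeylGroup b B := Subgroup.subset_closure

variable (hB : ∀ x, x ≠ 0 → 0 < B.form x x)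
  [Finite ι] [Nonempty ι] [P.IsCrystallographic] [P.IsReduced] [P.IsRootSystem] [P.IsIrreducible]

include hB

/-- Simple reflections are involutions, so words need no inverses. -/
theorem exists_word {b : P.Base} {w : AffineSpace V ≃ₗ[ℝ] AffineSpace V}
    (hw : w ∈ affineWeylGroup b B) :
    ∃ l : List (AffineSpace V ≃ₗ[ℝ] AffineSpace V),
      (∀ s ∈ l, s ∈ simpleReflections b B) ∧ l.prod = w := by
  rw [affineWeylGroup, ← Subgroup.mem_toSubmonoid, Subgroup.closure_toSubmonoid] at hw
  obtain ⟨l, hl, rfl⟩ := Submonoid.exists_list_of_mem_closure hw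
  refine ⟨l, fun s hs ↦ ?_, rfl⟩
  rcases hl s hs with h | ⟨a, ha, h⟩
  · exact h
  · have h' : IsAffineReflection B a s⁻¹ := h
    have h2 := h'.mul_self (affineInner_self_ne_zero B (isAffineRoot_of_simple B hB ha))
    have : s⁻¹ = s := by
      rw [mul_eq_one_iff_eq_inv, inv_inv] at h2
      exact h2
    rw [this] at h
    exact ⟨a, ha, h⟩

theorem affineWeylGroup_induction {b : P.Base}
    {p : (AffineSpace V ≃ₗ[ℝ] AffineSpace V) → Prop} (h1 : p 1)
    (hmul : ∀ s w, s ∈ simpleReflections b B → p w → p (s * w))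
    {w : AffineSpace V ≃ₗ[ℝ] AffineSpace V} (hw : w ∈ affineWeylGroup b B) : p w := by
  obtain ⟨l, hl, rfl⟩ := exists_word hB hw
  induction l with
  | nil => exact h1
  | cons s l ih =>
    rw [List.prod_cons]
    have hl' : ∀ t ∈ l, t ∈ simpleReflections b B := fun t ht ↦ hl t (List.mem_cons_of_mem _ ht)
    exact hmul _ _ (hl s List.mem_cons_self)
      (ih hl' (list_prod_mem fun t ht ↦ simpleReflections_subset b B (hl' t ht)))

theorem isAffineIsometry_of_mem {b : P.Base} {w : AffineSpace V ≃ₗ[ℝ] AffineSpace V}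
    (hw : w ∈ affineWeylGroup b B) : IsAffineIsometry B w := by
  refine affineWeylGroup_induction hB (b := b) (p := IsAffineIsometry B) (fun x y ↦ rfl) ?_ hw
  rintro s w ⟨a, ha, hs⟩ hw x y
  rw [LinearEquiv.mul_apply, LinearEquiv.mul_apply,
    hs.isometry (affineInner_self_ne_zero B (isAffineRoot_of_simple B hB ha)), hw]

theorem apply_delta_of_mem {b : P.Base} {w : AffineSpace V ≃ₗ[ℝ] AffineSpace V}
    (hw : w ∈ affineWeylGroup b B) : w (0, 1, 0) = (0, 1, 0) := by
  refine affineWeylGroup_induction hB (b := b) (p := fun w ↦ w (0, 1, 0) = (0, 1, 0)) rfl ?_ hw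
  rintro s w ⟨a, ha, hs⟩ hw
  obtain ⟨i, k, rfl⟩ := isAffineRoot_of_simple B hB ha
  rw [LinearEquiv.mul_apply, hw, hs.apply_delta]

theorem isAffineRoot_apply_of_mem {b : P.Base} {w : AffineSpace V ≃ₗ[ℝ] AffineSpace V}
    (hw : w ∈ affineWeylGroup b B) {x : AffineSpace V} (hx : IsAffineRoot P x) :
    IsAffineRoot P (w x) := by
  refine affineWeylGroup_induction hB (b := b) (p := fun w ↦ IsAffineRoot P (w x)) hx ?_ hw
  rintro s w ⟨a, ha, hs⟩ hw
  exact hs.isAffineRoot (isAffineRoot_of_simple B hB ha) hw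

/-- If a word makes a simple affine root negative, then multiplication with the reflection in that
root shortens it. -/
theorem exists_shorter_word {b : P.Base} {a : AffineSpace V} (ha : a ∈ affineSimpleRoots b)
    {r : AffineSpace V ≃ₗ[ℝ] AffineSpace V} (hr : IsAffineReflection B a r)
    (l : List (AffineSpace V ≃ₗ[ℝ] AffineSpace V))
    (hl : ∀ s ∈ l, s ∈ simpleReflections b B) (hneg : l.prod a ∉ positiveAffineRoots b) :
    ∃ l' : List (AffineSpace V ≃ₗ[ℝ] AffineSpace V),
      (∀ s ∈ l', s ∈ simpleReflections b B) ∧ l'.prod = l.prod * r ∧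
      l'.length + 1 = l.length := by
  induction l with
  | nil => exact absurd (affineSimpleRoots_subset B hB b ha) hneg
  | cons s l ih =>
    have hl' : ∀ t ∈ l, t ∈ simpleReflections b B := fun t ht ↦ hl t (List.mem_cons_of_mem _ ht)
    have hmem : l.prod ∈ affineWeylGroup b B :=
      list_prod_mem fun t ht ↦ simpleReflections_subset b B (hl' t ht)
    obtain ⟨c, hc, hs⟩ := hl s List.mem_cons_self
    have hc0 := affineInner_self_ne_zero B (isAffineRoot_of_simple B hB hc)
    by_cases hpos : l.prod a ∈ positiveAffineRoots b
    -- The letter `s` makes the positive root `l.prod a` negative, and `c` is the only root it can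
    -- do this to. So `s` is the conjugate of `r` by `l.prod` and can be deleted.
    · have hac : l.prod a = c := by
        by_contra hne
        rw [List.prod_cons, LinearEquiv.mul_apply] at hneg
        exact hneg (reflection_mem_positiveAffineRoots B hB hc hs hpos hne)
      have hconj := hr.conj (isAffineIsometry_of_mem hB hmem)
      rw [hac] at hconj
      have hseq := hs.unique hconj
      refine ⟨l, hl', ?_, rfl⟩
      have hrr := hr.mul_self (affineInner_self_ne_zero B (isAffineRoot_of_simple B hB ha))
      rw [List.prod_cons, hseq, mul_assoc, mul_assoc, mul_assoc, inv_mul_cancel_left, hrr, mul_one]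
    · obtain ⟨l', h1, h2, h3⟩ := ih hl' hpos
      refine ⟨s :: l', ?_, ?_, by simp [h3]⟩
      · intro t ht
        rcases List.mem_cons.1 ht with rfl | ht
        · exact ⟨c, hc, hs⟩
        · exact h1 t ht
      · rw [List.prod_cons, h2, List.prod_cons, mul_assoc]

/-- The affine Weyl group acts freely: only `1` preserves positivity. -/
theorem eq_one_of_forall_pos {b : P.Base} {w : AffineSpace V ≃ₗ[ℝ] AffineSpace V}
    (hw : w ∈ affineWeylGroup b B)
    (hpos : ∀ x ∈ positiveAffineRoots b, w x ∈ positiveAffineRoots b) : w = 1 := by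
  obtain ⟨l₀, hl₀, hl₀w⟩ := exists_word hB hw
  obtain ⟨n, hn⟩ : ∃ n, l₀.length = n := ⟨_, rfl⟩
  induction n using Nat.strong_induction_on generalizing l₀ with
  | _ n ih =>
    rcases l₀.eq_nil_or_concat with rfl | ⟨l, s, rfl⟩
    · simpa using hl₀w.symm
    have hl : ∀ t ∈ l, t ∈ simpleReflections b B := fun t ht ↦ hl₀ t (by simp [ht])
    obtain ⟨a, ha, hs⟩ := hl₀ s (by simp)
    have ha' := affineSimpleRoots_subset B hB b ha
    have har := isAffineRoot_of_pos ha'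
    have ha0 := affineInner_self_ne_zero B har
    have hmem : l.prod ∈ affineWeylGroup b B :=
      list_prod_mem fun t ht ↦ simpleReflections_subset b B (hl t ht)
    have hprod : l.prod * s = w := by simpa using hl₀w
    have hneg : l.prod a ∉ positiveAffineRoots b := by
      have h1 := hpos a ha'
      rw [← hprod, LinearEquiv.mul_apply, hs.apply_self ha0, map_neg,
        neg_mem_positiveAffineRoots_iff (isAffineRoot_apply_of_mem hB hmem har)] at h1
      exact h1
    -- The word `l'` has the same product `w` and is two letters shorter than the given one.
    obtain ⟨l', h1, h2, h3⟩ := exists_shorter_word hB ha hs l hl hneg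
    refine ih l'.length ?_ l' h1 (h2.trans hprod) rfl
    simp at hn
    omega

theorem apply_pos_iff_of_inversionSet_eq {b : P.Base} {w w' : AffineSpace V ≃ₗ[ℝ] AffineSpace V}
    (hw : w ∈ affineWeylGroup b B) (hw' : w' ∈ affineWeylGroup b B)
    (h : inversionSet b w = inversionSet b w') {x : AffineSpace V} (hx : IsAffineRoot P x) :
    w x ∈ positiveAffineRoots b ↔ w' x ∈ positiveAffineRoots b := by
  have key : ∀ x ∈ positiveAffineRoots b,
      (w x ∈ positiveAffineRoots b ↔ w' x ∈ positiveAffineRoots b) := by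
    intro x hx
    have h1 := isAffineRoot_of_pos hx
    have h2 : x ∈ inversionSet b w ↔ x ∈ inversionSet b w' := by rw [h]
    simp only [inversionSet, Set.mem_ofPred_eq, hx, true_and,
      neg_mem_positiveAffineRoots_iff (isAffineRoot_apply_of_mem hB hw h1),
      neg_mem_positiveAffineRoots_iff (isAffineRoot_apply_of_mem hB hw' h1)] at h2
    exact not_iff_not.1 h2
  by_cases hpos : x ∈ positiveAffineRoots b
  · exact key x hpos
  · rw [← neg_mem_positiveAffineRoots_iff hx] at hpos
    have := key _ hpos
    rw [map_neg, map_neg,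
      neg_mem_positiveAffineRoots_iff (isAffineRoot_apply_of_mem hB hw hx),
      neg_mem_positiveAffineRoots_iff (isAffineRoot_apply_of_mem hB hw' hx)] at this
    exact not_iff_not.1 this

/-- An element of the affine Weyl group is determined by its inversion set. -/
theorem eq_of_inversionSet_eq {b : P.Base} {w w' : AffineSpace V ≃ₗ[ℝ] AffineSpace V}
    (hw : w ∈ affineWeylGroup b B) (hw' : w' ∈ affineWeylGroup b B)
    (h : inversionSet b w = inversionSet b w') : w = w' := by
  rw [← mul_inv_eq_one]
  refine eq_one_of_forall_pos hB (mul_mem hw (inv_mem hw')) fun x hx ↦ ?_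
  have hx' := isAffineRoot_apply_of_mem hB (inv_mem hw') (isAffineRoot_of_pos hx)
  rw [LinearEquiv.mul_apply, apply_pos_iff_of_inversionSet_eq hB hw hw' h hx',
    ← LinearEquiv.mul_apply, mul_inv_cancel]
  exact hx

/-- The reflection in any affine root belongs to the affine Weyl group. -/
theorem exists_reflection_mem (b : P.Base) {x : AffineSpace V} (hx : IsAffineRoot P x) :
    ∃ s ∈ affineWeylGroup b B, IsAffineReflection B x s := by
  obtain ⟨t, ht, -⟩ := exists_highestRoot B hB b
  -- The affine height: weight `ht θ + 1` on `δ` makes it `1` on `δ - θ` too. Induction on it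
  -- conjugates a positive root down to a simple one.
  let G : AffineSpace V →ₗ[ℝ] ℝ := (heightForm b) ∘ₗ LinearMap.fst ℝ V (ℝ × ℝ) +
    ((b.height t + 1 : ℤ) : ℝ) • (LinearMap.fst ℝ ℝ ℝ ∘ₗ LinearMap.snd ℝ V (ℝ × ℝ))
  have hG : ∀ a ∈ affineSimpleRoots b, G a = 1 := by
    rintro a (rfl | ⟨i, hi, rfl⟩)
    · simp [G, ht, heightForm_root]
    · simp [G, heightForm_simple b hi]
  have hGnat : ∀ y ∈ AddSubmonoid.closure (affineSimpleRoots b), ∃ n : ℕ, G y = n := by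
    intro y hy
    induction hy using AddSubmonoid.closure_induction with
    | mem y hy => exact ⟨1, by simp [hG y hy]⟩
    | zero => exact ⟨0, by simp⟩
    | add y z _ _ hy hz =>
      obtain ⟨m, hm⟩ := hy
      obtain ⟨n, hn⟩ := hz
      exact ⟨m + n, by simp [hm, hn]⟩
  have key : ∀ (n : ℕ) (x : AffineSpace V), x ∈ positiveAffineRoots b → G x = n →
      ∃ s ∈ affineWeylGroup b B, IsAffineReflection B x s := by
    intro n
    induction n using Nat.strong_induction_on with
    | _ n ih =>
      intro x hx hn
      have hxr := isAffineRoot_of_pos hx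
      -- Otherwise `(x, x) ≤ 0`, since `x` is a non-negative combination of simple affine roots.
      obtain ⟨a, ha, hxa⟩ : ∃ a ∈ affineSimpleRoots b, 0 < affineInner B x a := by
        by_contra! hle
        have hall : ∀ y ∈ AddSubmonoid.closure (affineSimpleRoots b),
            affineInner B x y ≤ 0 := by
          intro y hy
          induction hy using AddSubmonoid.closure_induction with
          | mem y hy => exact hle y hy
          | zero => simp [affineInner]
          | add y z _ _ hy hz =>
            rw [affineInner_comm, affineInner_add_left, affineInner_comm B y,
              affineInner_comm B z]
            linarith
        have h1 := hall x (mem_closure_affineSimpleRoots B hB hx)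
        obtain ⟨i, k, rfl⟩ := hxr
        have h2 := hB _ (P.ne_zero i)
        simp only [affineInner, mul_zero, zero_mul, add_zero] at h1
        linarith
      have har := isAffineRoot_of_simple B hB ha
      have ha0 := affineInner_self_ne_zero B har
      obtain ⟨s, hs⟩ := exists_isAffineReflection ha0
      have hsmem : s ∈ affineWeylGroup b B := Subgroup.subset_closure ⟨a, ha, hs⟩
      by_cases hxeq : x = a
      · exact ⟨s, hsmem, hxeq ▸ hs⟩
      have hpos := reflection_mem_positiveAffineRoots B hB ha hs hx hxeq
      obtain ⟨m, hm⟩ := hGnat _ (mem_closure_affineSimpleRoots B hB hpos)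
      have haa : 0 < affineInner B a a := by
        obtain ⟨i, k, rfl⟩ := har
        simpa [affineInner] using hB _ (P.ne_zero i)
      have hlt : m < n := by
        have h1 : G (s x) = G x - affineInner B x a * (2 / affineInner B a a) := by
          rw [hs, map_sub, map_smul, map_smul, hG a ha]; simp
        have h2 : 0 < affineInner B x a * (2 / affineInner B a a) := by positivity
        have : (m : ℝ) < n := by rw [← hm, ← hn]; linarith
        exact_mod_cast this
      obtain ⟨r, hr, hrs⟩ := ih m hlt _ hpos hm
      have hconj := hrs.conj (hs.isometry ha0)
      rw [hs.apply_apply ha0] at hconj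
      exact ⟨_, mul_mem (mul_mem hsmem hr) (inv_mem hsmem), hconj⟩
  have key' : ∀ x ∈ positiveAffineRoots b,
      ∃ s ∈ affineWeylGroup b B, IsAffineReflection B x s := by
    intro x hx
    obtain ⟨n, hn⟩ := hGnat x (mem_closure_affineSimpleRoots B hB hx)
    exact key n x hx hn
  by_cases hpos : x ∈ positiveAffineRoots b
  · exact key' x hpos
  · rw [← neg_mem_positiveAffineRoots_iff hx] at hpos
    obtain ⟨s, hs, hsr⟩ := key' _ hpos
    refine ⟨s, hs, fun y ↦ ?_⟩
    rw [hsr y]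
    have h1 : ∀ y, affineInner B y (-x) = -affineInner B y x := fun y ↦ by
      rw [← neg_one_smul ℝ x, affineInner_smul_right]; ring
    rw [h1, h1, affineInner_comm B (-x), h1]
    simp

omit hB [Nonempty ι] [P.IsCrystallographic] [P.IsReduced] [P.IsRootSystem] [P.IsIrreducible] in
-- For each of the finitely many `γ`, positivity bounds the level below and `F < 0` bounds it above.
-- The cardinality measures the distance from the fundamental chamber.
theorem finite_setOf_neg (b : P.Base) (F : AffineSpace V →ₗ[ℝ] ℝ) (hδ : 0 < F (0, 1, 0)) :
    {x | x ∈ positiveAffineRoots b ∧ F x < 0}.Finite := by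
  refine (Set.finite_iUnion fun i : ι ↦
    ((Set.finite_Icc (0 : ℤ) ⌈-F (P.root i, 0, 0) / F (0, 1, 0)⌉).image
      fun k : ℤ ↦ ((P.root i, (k : ℝ), 0) : AffineSpace V))).subset ?_
  rintro _ ⟨⟨i, k, rfl, hk⟩, hneg⟩
  refine Set.mem_iUnion.2 ⟨i, k, ⟨by omega, ?_⟩, rfl⟩
  have h1 : ((P.root i, (k : ℝ), 0) : AffineSpace V) =
      (P.root i, 0, 0) + (k : ℝ) • (0, 1, 0) := by ext <;> simp
  rw [h1, map_add, map_smul, smul_eq_mul] at hneg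
  have h2 : (k : ℝ) ≤ -F (P.root i, 0, 0) / F (0, 1, 0) := by
    rw [le_div_iff₀ hδ]; linarith
  exact_mod_cast h2.trans (Int.le_ceil _)

/-- Every generic linear form is moved into the fundamental chamber by the affine Weyl group. -/
theorem exists_mem_forall_pos (b : P.Base) (F : AffineSpace V →ₗ[ℝ] ℝ) (hδ : 0 < F (0, 1, 0))
    (hF : ∀ x, IsAffineRoot P x → F x ≠ 0) :
    ∃ w ∈ affineWeylGroup b B, ∀ x ∈ positiveAffineRoots b, 0 < F (w x) := by
  obtain ⟨n, hn⟩ : ∃ n, {x | x ∈ positiveAffineRoots b ∧ F x < 0}.ncard = n := ⟨_, rfl⟩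
  induction n using Nat.strong_induction_on generalizing F with
  | _ n ih =>
    by_cases hall : ∀ a ∈ affineSimpleRoots b, 0 < F a
    · refine ⟨1, one_mem _, fun x hx ↦ lt_of_le_of_ne ?_ (hF x (isAffineRoot_of_pos hx)).symm⟩
      exact AddSubmonoid.closure_induction (motive := fun y _ ↦ 0 ≤ F y) (fun y hy ↦ (hall y hy).le) (by simp)
        (fun y z _ _ hy hz ↦ by rw [map_add]; exact add_nonneg hy hz)
        (mem_closure_affineSimpleRoots B hB hx)
    · push Not at hall
      obtain ⟨a, ha, hle⟩ := hall
      have har := isAffineRoot_of_simple B hB ha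
      have ha0 := affineInner_self_ne_zero B har
      have hneg : F a < 0 := lt_of_le_of_ne hle (hF a har)
      obtain ⟨s, hs⟩ := exists_isAffineReflection ha0
      have hsmem : s ∈ affineWeylGroup b B := Subgroup.subset_closure ⟨a, ha, hs⟩
      have hfin := finite_setOf_neg b F hδ
      -- The reflection `s` maps the new set into the old one and misses `a`, on which `F` is
      -- negative.
      have hlt : {x | x ∈ positiveAffineRoots b ∧ (F ∘ₗ s.toLinearMap) x < 0}.ncard < n := by
        rw [← hn, ← Set.ncard_image_of_injective _ s.injective]
        refine Set.ncard_lt_ncard ⟨?_, fun hsub ↦ ?_⟩ hfin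
        · rintro _ ⟨x, ⟨hx, hFx⟩, rfl⟩
          refine ⟨reflection_mem_positiveAffineRoots B hB ha hs hx ?_, hFx⟩
          rintro rfl
          simp [hs.apply_self ha0] at hFx
          linarith
        · obtain ⟨x, ⟨hx, -⟩, hxa⟩ := hsub
            (⟨affineSimpleRoots_subset B hB b ha, hneg⟩ : a ∈ {x | x ∈ positiveAffineRoots b ∧ F x < 0})
          have : x = -a := by
            rw [← hs.apply_apply ha0 x, hxa, hs.apply_self ha0]
          rw [this, neg_mem_positiveAffineRoots_iff har] at hx
          exact hx (affineSimpleRoots_subset B hB b ha)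
      obtain ⟨w, hw, hpos⟩ := ih _ hlt (F ∘ₗ s.toLinearMap)
        (by simpa [apply_delta_of_mem hB hsmem] using hδ)
        (fun x hx ↦ hF _ (isAffineRoot_apply_of_mem hB hsmem hx)) rfl
      exact ⟨s * w, mul_mem hsmem hw, hpos⟩

end AffineWeyl

/-! ### Abelian sets of roots and minuscule elements. -/

section AbelianSets

variable {ι V N : Type*} [AddCommGroup V] [Module ℝ V] [AddCommGroup N] [Module ℝ N]
  {P : RootPairing ι ℝ V N} {B : P.InvariantForm}

/-- The sets of positive roots which belong to abelian ideals. -/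
structure IsAbelianSet (b : P.Base) (C : Set ι) : Prop where
  isPos : ∀ i ∈ C, b.IsPos i
  add_mem : ∀ i ∈ C, ∀ j, b.IsPos j → ∀ k, P.root k = P.root i + P.root j → k ∈ C
  add_ne : ∀ i ∈ C, ∀ j ∈ C, ∀ k, P.root k ≠ P.root i + P.root j

theorem delta_sub_injective :
    Function.Injective fun i ↦ ((-P.root i, 1, 0) : AffineSpace V) := by
  intro i j h
  simpa using h

theorem delta_sub_mem_positiveAffineRoots (b : P.Base) (i : ι) :
    ((-P.root i, 1, 0) : AffineSpace V) ∈ positiveAffineRoots b :=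
  ⟨P.reflectionPerm i i, 1, by simp, Or.inl le_rfl⟩

theorem IsMinusculeWith.mem_iff {b : P.Base} {w : AffineSpace V ≃ₗ[ℝ] AffineSpace V} {C : Set ι}
    (h : IsMinusculeWith b w C) {i : ι} :
    ((-P.root i, 1, 0) : AffineSpace V) ∈ inversionSet b w ↔ i ∈ C := by
  rw [h]
  exact delta_sub_injective.mem_set_image

theorem IsMinusculeWith.unique {b : P.Base} {w : AffineSpace V ≃ₗ[ℝ] AffineSpace V}
    {C C' : Set ι} (h : IsMinusculeWith b w C) (h' : IsMinusculeWith b w C') : C = C' :=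
  Set.ext fun _ ↦ h.mem_iff.symm.trans h'.mem_iff

variable (hB : ∀ x, x ≠ 0 → 0 < B.form x x)
  [Finite ι] [Nonempty ι] [P.IsCrystallographic] [P.IsReduced] [P.IsRootSystem] [P.IsIrreducible]

include hB

theorem IsMinusculeWith.apply_mem {b : P.Base} {w : AffineSpace V ≃ₗ[ℝ] AffineSpace V} {C : Set ι}
    (hw : w ∈ affineWeylGroup b B) (h : IsMinusculeWith b w C) {x : AffineSpace V}
    (hx : x ∈ positiveAffineRoots b) (hxC : ∀ i ∈ C, x ≠ (-P.root i, 1, 0)) :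
    w x ∈ positiveAffineRoots b := by
  by_contra hneg
  rw [← neg_mem_positiveAffineRoots_iff
    (isAffineRoot_apply_of_mem hB hw (isAffineRoot_of_pos hx))] at hneg
  have hmem : x ∈ inversionSet b w := ⟨hx, hneg⟩
  rw [h] at hmem
  obtain ⟨i, hi, rfl⟩ := hmem
  exact hxC i hi rfl

/-- An element whose inversions have level one is minuscule with an abelian set of roots. -/
theorem isAbelianSet_of_inversionSet {b : P.Base} {w : AffineSpace V ≃ₗ[ℝ] AffineSpace V}
    (hw : w ∈ affineWeylGroup b B)
    (hN : ∀ x ∈ inversionSet b w, ∃ i, b.IsPos i ∧ x = (-P.root i, 1, 0)) :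
    ∃ C, IsAbelianSet b C ∧ IsMinusculeWith b w C := by
  have hmin : IsMinusculeWith b w {i | ((-P.root i, 1, 0) : AffineSpace V) ∈ inversionSet b w} := by
    ext x
    constructor
    · intro hx
      obtain ⟨i, -, rfl⟩ := hN x hx
      exact ⟨i, hx, rfl⟩
    · rintro ⟨i, hi, rfl⟩
      exact hi
  refine ⟨_, ⟨?_, ?_, ?_⟩, hmin⟩
  · intro i hi
    obtain ⟨j, hj, hij⟩ := hN _ hi
    rwa [delta_sub_injective hij]
  · intro i hi j hj k hk
    have hjpos : ((P.root j, 0, 0) : AffineSpace V) ∈ positiveAffineRoots b :=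
      ⟨j, 0, by simp, Or.inr ⟨rfl, hj⟩⟩
    have hkpos := delta_sub_mem_positiveAffineRoots b k
    have h1 := hmin.apply_mem hB hw hjpos (fun l _ h ↦ by simp at h)
    -- Level zero roots are not inverted, so the right side is a sum of two positive roots.
    have h2 : -w (-P.root k, 1, 0) = -w (-P.root i, 1, 0) + w (P.root j, 0, 0) := by
      rw [← map_neg w, ← map_neg w, ← map_add w, hk]
      congr 1
      ext <;> simp [add_comm]
    have h3 := (isAffineRoot_apply_of_mem hB hw (isAffineRoot_of_pos hkpos)).neg
    refine ⟨hkpos, ?_⟩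
    rw [h2] at h3 ⊢
    exact sum_mem_positiveAffineRoots hi.2 h1 h3
  · intro i hi j hj k hk
    -- If `γ_k = γ_i + γ_j`, then `2δ - γ_k` would be an inversion of level two.
    have hkpos : ((-P.root k, 2, 0) : AffineSpace V) ∈ positiveAffineRoots b :=
      ⟨P.reflectionPerm k k, 2, by simp, Or.inl (by norm_num)⟩
    have h2 : -w (-P.root k, 2, 0) = -w (-P.root i, 1, 0) + -w (-P.root j, 1, 0) := by
      rw [← map_neg w, ← map_neg w, ← map_neg w, ← map_add w, hk]
      congr 1
      ext <;> simp
      norm_num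
    have h3 := (isAffineRoot_apply_of_mem hB hw (isAffineRoot_of_pos hkpos)).neg
    have h4 : ((-P.root k, 2, 0) : AffineSpace V) ∈ inversionSet b w := by
      refine ⟨hkpos, ?_⟩
      rw [h2] at h3 ⊢
      exact sum_mem_positiveAffineRoots hi.2 hj.2 h3
    obtain ⟨l, -, hl⟩ := hN _ h4
    simp at hl

/-- Removal of a root of minimal height from an abelian set corresponds to a simple affine root. -/
theorem apply_delta_sub_mem_affineSimpleRoots {b : P.Base}
    {w : AffineSpace V ≃ₗ[ℝ] AffineSpace V} {C : Set ι}
    (hC : IsAbelianSet b C) {i : ι} (hi : i ∈ C) (hw : w ∈ affineWeylGroup b B)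
    (h : IsMinusculeWith b w (C \ {i})) :
    w (-P.root i, 1, 0) ∈ affineSimpleRoots b := by
  by_contra hns
  have hpos : w (-P.root i, 1, 0) ∈ positiveAffineRoots b := by
    refine h.apply_mem hB hw (delta_sub_mem_positiveAffineRoots b i) fun j hj hij ↦ hj.2 ?_
    exact (delta_sub_injective hij).symm
  -- a root whose image is positive while itself negative is `γ - δ` with `γ` in the set
  have hneg : ∀ p (m : ℤ), ((P.root p, (m : ℝ), 0) : AffineSpace V) ∉ positiveAffineRoots b →
      w (P.root p, (m : ℝ), 0) ∈ positiveAffineRoots b → p ∈ C ∧ m = -1 := by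
    intro p m h1 h2
    have h3 : -(P.root p, (m : ℝ), 0) ∈ inversionSet b w :=
      ⟨(neg_mem_positiveAffineRoots_iff ⟨p, m, rfl⟩).2 h1, by rwa [map_neg, neg_neg]⟩
    rw [h] at h3
    obtain ⟨j, hj, hj'⟩ := h3
    simp only [Prod.neg_mk, Prod.mk.injEq, neg_inj, EmbeddingLike.apply_eq_iff_eq] at hj'
    obtain ⟨rfl, hm, -⟩ := hj'
    refine ⟨hj.1, ?_⟩
    have : (m : ℝ) = ((-1 : ℤ) : ℝ) := by push_cast; linarith
    exact_mod_cast this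
  -- Splitting `δ - γ_i` puts the first summand at level `m ≤ 0`. If that summand is positive, then
  -- `m = 0` and `γ_i + γ_p` lies in `C` by upward closure, so the second summand is inverted. If it
  -- is negative, it is `γ_p - δ` with `γ_p ∈ C`, and `γ_i + γ_p` is a root, against abelianness.
  have key : ∀ p q (m l : ℤ), P.root p + P.root q = -P.root i → m + l = 1 → m ≤ l →
      w (P.root p, (m : ℝ), 0) ∈ positiveAffineRoots b →
      w (P.root q, (l : ℝ), 0) ∈ positiveAffineRoots b → False := by
    intro p q m l hpq hml hle hwp hwq
    have hq' : P.root (P.reflectionPerm q q) = P.root i + P.root p := by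
      rw [RootPairing.root_reflectionPerm, RootPairing.reflection_apply_self,
        ← neg_eq_iff_eq_neg.2 hpq]
      abel
    by_cases hp : ((P.root p, (m : ℝ), 0) : AffineSpace V) ∈ positiveAffineRoots b
    · obtain h1 | ⟨rfl, hppos⟩ := (mem_positiveAffineRoots_iff b p m).1 hp
      · omega
      obtain rfl : l = 1 := by omega
      have hqC : P.reflectionPerm q q ∈ C \ {i} := by
        refine ⟨hC.add_mem i hi p hppos _ hq', fun hqi ↦ ?_⟩
        rw [Set.mem_singleton_iff.1 hqi] at hq'
        exact P.ne_zero p (by simpa using hq')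
      have h2 := (h.mem_iff.2 hqC).2
      have h3 : ((-P.root (P.reflectionPerm q q), 1, 0) : AffineSpace V) =
          (P.root q, ((1 : ℤ) : ℝ), 0) := by simp
      rw [h3, neg_mem_positiveAffineRoots_iff (isAffineRoot_of_pos hwq)] at h2
      exact h2 hwq
    · obtain ⟨hpC, -⟩ := hneg p m hp hwp
      exact hC.add_ne i hi p hpC _ hq'
  obtain ⟨c, hc, hcase⟩ := exists_sub_simple_mem B hB hpos hns
  obtain ⟨y, rfl⟩ := w.surjective c
  have hyr : IsAffineRoot P y := by
    have := isAffineRoot_apply_of_mem hB (inv_mem hw) (isAffineRoot_of_simple B hB hc)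
    rwa [← LinearEquiv.mul_apply, inv_mul_cancel] at this
  obtain ⟨p, m, rfl⟩ := hyr
  have hcpos := affineSimpleRoots_subset B hB b hc
  rw [← map_sub] at hcase
  rcases hcase with hreal | ⟨k, hk, him⟩
  · have hr : IsAffineRoot P ((-P.root i, 1, 0) - (P.root p, (m : ℝ), 0) : AffineSpace V) := by
      have := isAffineRoot_apply_of_mem hB (inv_mem hw) (isAffineRoot_of_pos hreal)
      rwa [← LinearEquiv.mul_apply, inv_mul_cancel] at this
    obtain ⟨q, l, hql⟩ := hr
    rw [hql] at hreal
    simp only [Prod.mk_sub_mk, Prod.mk.injEq] at hql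
    have h1 : P.root p + P.root q = -P.root i := by rw [← hql.1]; abel
    have h2 : m + l = 1 := by
      have : (m : ℝ) + l = 1 := by rw [← hql.2.1]; ring
      exact_mod_cast this
    rcases le_total m l with hml | hml
    · exact key p q m l h1 h2 hml hcpos hreal
    · exact key q p l m (by rw [add_comm, h1]) (by omega) hml hreal hcpos
  -- The subtracted root is the image of the negative root `-γ_i + (1 - k)δ`; its positivity would
  -- put `-γ_i` in `C`.
  · have h1 : w (0, (k : ℝ), 0) = (0, (k : ℝ), 0) := by
      have : ((0, (k : ℝ), 0) : AffineSpace V) = (k : ℝ) • (0, 1, 0) := by simp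
      rw [this, map_smul, apply_delta_of_mem hB hw]
    rw [← h1] at him
    have h2 := w.injective him
    simp only [Prod.mk_sub_mk, Prod.mk.injEq] at h2
    have h3 : P.root p = P.root (P.reflectionPerm i i) := by
      rw [RootPairing.root_reflectionPerm, RootPairing.reflection_apply_self]
      exact (sub_eq_zero.1 h2.1).symm
    obtain rfl := P.root.injective h3
    have h4 : m + k = 1 := by
      have : (m : ℝ) + k = 1 := by linarith [h2.2.1]
      exact_mod_cast this
    have hnp : ¬ b.IsPos (P.reflectionPerm i i) := by
      have h5 := hC.isPos i hi
      rw [isPos_iff_heightForm] at h5 ⊢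
      simp at h5 ⊢
      exact h5.le
    have h6 : ((P.root (P.reflectionPerm i i), (m : ℝ), 0) : AffineSpace V) ∉
        positiveAffineRoots b := by
      rw [mem_positiveAffineRoots_iff]
      rintro (h | ⟨-, h⟩)
      · omega
      · exact hnp h
    exact hnp (hC.isPos _ (hneg _ _ h6 hcpos).1)

/-- Every abelian set comes from a minuscule element of the affine Weyl group. -/
theorem IsAbelianSet.exists_isMinusculeWith {b : P.Base} {C : Set ι} (hC : IsAbelianSet b C) :
    ∃ w ∈ affineWeylGroup b B, IsMinusculeWith b w C := by
  obtain ⟨n, hn⟩ : ∃ n, C.ncard = n := ⟨_, rfl⟩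
  induction n generalizing C with
  | zero =>
    obtain rfl := (Set.ncard_eq_zero (Set.toFinite C)).1 hn
    refine ⟨1, one_mem _, ?_⟩
    rw [IsMinusculeWith, Set.image_empty, Set.eq_empty_iff_forall_notMem]
    rintro x ⟨h1, h2⟩
    exact (neg_mem_positiveAffineRoots_iff (isAffineRoot_of_pos h1)).1 h2 h1
  | succ n ih =>
    obtain ⟨i, hi, hmin⟩ := (Set.toFinite C).exists_minimalFor (fun j ↦ b.height j) C
      (Set.nonempty_of_ncard_ne_zero (by omega))
    -- Minimal height keeps upward closure: the removed root is not a root of `C` plus a positive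
    -- root.
    have hC' : IsAbelianSet b (C \ {i}) := by
      refine ⟨fun j hj ↦ hC.isPos j hj.1, fun j hj k hk l hl ↦
        ⟨hC.add_mem j hj.1 k hk l hl, ?_⟩, fun j hj k hk ↦ hC.add_ne j hj.1 k hk.1⟩
      rintro rfl
      have h1 := b.height_add hl
      rw [RootPairing.Base.isPos_iff] at hk
      have := hmin hj.1 (by simp; omega)
      simp at this
      omega
    obtain ⟨w, hw, hwm⟩ := ih hC' (by rw [Set.ncard_sdiff_singleton_of_mem hi]; omega)
    have hsimple := apply_delta_sub_mem_affineSimpleRoots hB hC hi hw hwm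
    have har := isAffineRoot_of_simple B hB hsimple
    have ha0 := affineInner_self_ne_zero B har
    obtain ⟨s, hs⟩ := exists_isAffineReflection ha0
    have hsmem : s ∈ affineWeylGroup b B := Subgroup.subset_closure ⟨_, hsimple, hs⟩
    -- Composing with the reflection in the simple root `w(δ - γ_i)` adds exactly `δ - γ_i` to the
    -- inversions.
    refine ⟨s * w, mul_mem hsmem hw, ?_⟩
    have hxpos := delta_sub_mem_positiveAffineRoots b i
    ext y
    have himg : y ∈ (fun i ↦ ((-P.root i, 1, 0) : AffineSpace V)) '' C ↔
        y = (-P.root i, 1, 0) ∨ y ∈ inversionSet b w := by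
      rw [hwm]
      constructor
      · rintro ⟨j, hj, rfl⟩
        by_cases hji : j = i
        · exact Or.inl (by rw [hji])
        · exact Or.inr ⟨j, ⟨hj, hji⟩, rfl⟩
      · rintro (rfl | ⟨j, hj, rfl⟩)
        · exact ⟨i, hi, rfl⟩
        · exact ⟨j, hj.1, rfl⟩
    rw [himg]
    constructor
    · rintro ⟨hy, hneg⟩
      rw [LinearEquiv.mul_apply] at hneg
      by_cases hyx : y = (-P.root i, 1, 0)
      · exact Or.inl hyx
      right
      refine ⟨hy, ?_⟩
      have hwy := isAffineRoot_apply_of_mem hB hw (isAffineRoot_of_pos hy)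
      rw [neg_mem_positiveAffineRoots_iff hwy]
      intro hwpos
      have := reflection_mem_positiveAffineRoots B hB hsimple hs hwpos
        fun h ↦ hyx (w.injective h)
      rw [neg_mem_positiveAffineRoots_iff (isAffineRoot_of_pos this)] at hneg
      exact hneg this
    · rintro (rfl | ⟨hy, hneg⟩)
      · refine ⟨hxpos, ?_⟩
        rw [LinearEquiv.mul_apply, hs.apply_self ha0, neg_neg]
        exact affineSimpleRoots_subset B hB b hsimple
      · refine ⟨hy, ?_⟩
        rw [LinearEquiv.mul_apply, ← map_neg]
        refine reflection_mem_positiveAffineRoots B hB hsimple hs hneg fun h ↦ ?_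
        have h2 : y = -(-P.root i, 1, 0) := by
          apply w.injective
          rw [map_neg, ← h, neg_neg]
        rw [h2, neg_mem_positiveAffineRoots_iff (isAffineRoot_of_pos hxpos)] at hy
        exact hy hxpos

end AbelianSets

/-! ### Linear and translation parts. -/

section Translations

variable {ι V N : Type*} [AddCommGroup V] [Module ℝ V] [AddCommGroup N] [Module ℝ N]
  {P : RootPairing ι ℝ V N} {B : P.InvariantForm}

/-- On the span of `V` and `δ`, the map `w` is the linear map `u` of `V` composed with the
translation by `q`. -/
def ActsBy (B : P.InvariantForm) (w : AffineSpace V ≃ₗ[ℝ] AffineSpace V) (u : V ≃ₗ[ℝ] V) (q : V) :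
    Prop :=
  ∀ (v : V) (a : ℝ), w (v, a, 0) = (u v, a + B.form q v, 0)

/-- The Weyl group as a group of linear automorphisms of `V`. -/
def linearWeylGroup (P : RootPairing ι ℝ V N) : Subgroup (V ≃ₗ[ℝ] V) :=
  Subgroup.closure (Set.range P.reflection)

theorem form_apply_apply_of_mem {u : V ≃ₗ[ℝ] V} (hu : u ∈ linearWeylGroup P) (x y : V) :
    B.form (u x) (u y) = B.form x y := by
  induction hu using Subgroup.closure_induction generalizing x y with
  | mem u hu =>
    obtain ⟨i, rfl⟩ := hu
    exact B.apply_reflection_reflection i x y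
  | one => rfl
  | mul u v _ _ hu hv => rw [LinearEquiv.mul_apply, LinearEquiv.mul_apply, hu, hv]
  | inv u _ hu =>
    rw [← hu, ← LinearEquiv.mul_apply, ← LinearEquiv.mul_apply, mul_inv_cancel]
    rfl

theorem form_apply_eq_of_mem {u : V ≃ₗ[ℝ] V} (hu : u ∈ linearWeylGroup P) (x y : V) :
    B.form x (u y) = B.form (u⁻¹ x) y := by
  rw [← form_apply_apply_of_mem (inv_mem hu), ← LinearEquiv.mul_apply, inv_mul_cancel]
  rfl

/-- The level shift is measured on the argument before `u` acts, so the left factor's translation is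
pulled back through `u'`. -/
theorem ActsBy.mul {w w' : AffineSpace V ≃ₗ[ℝ] AffineSpace V} {u u' : V ≃ₗ[ℝ] V} {q q' : V}
    (h : ActsBy B w u q) (h' : ActsBy B w' u' q') (hu' : u' ∈ linearWeylGroup P) :
    ActsBy B (w * w') (u * u') (q' + u'⁻¹ q) := by
  intro v a
  rw [LinearEquiv.mul_apply, h', h, form_apply_eq_of_mem hu', LinearEquiv.mul_apply, map_add,
    LinearMap.add_apply, add_assoc]

theorem ActsBy.inv {w : AffineSpace V ≃ₗ[ℝ] AffineSpace V} {u : V ≃ₗ[ℝ] V} {q : V}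
    (h : ActsBy B w u q) (hu : u ∈ linearWeylGroup P) : ActsBy B w⁻¹ u⁻¹ (-u q) := by
  intro v a
  apply w.injective
  rw [← LinearEquiv.mul_apply, mul_inv_cancel, h, form_apply_eq_of_mem (inv_mem hu), inv_inv,
    ← LinearEquiv.mul_apply, mul_inv_cancel]
  simp

theorem ActsBy.one : ActsBy B 1 1 0 := fun v a ↦ by simp

theorem IsAffineReflection.actsBy {i : ι} {k : ℤ} {s : AffineSpace V ≃ₗ[ℝ] AffineSpace V}
    (h : IsAffineReflection B (P.root i, (k : ℝ), 0) s) :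
    ActsBy B s (P.reflection i) (-k • corootVec B i) := by
  intro v a
  rw [h.apply_level, ← form_root_eq_coroot' B]
  simp only [corootVec, map_zsmul, map_smul, LinearMap.smul_apply, smul_eq_mul, form_comm B v]
  simp
  ring

theorem reflection_corootVec (i j : ι) :
    P.reflection i (corootVec B j) = corootVec B (P.reflectionPerm i j) := by
  rw [corootVec, corootVec, map_smul, RootPairing.root_reflectionPerm,
    B.apply_reflection_reflection]

theorem eq_of_forall_form_eq (hB : ∀ x, x ≠ 0 → 0 < B.form x x) {x y : V}
    (h : ∀ v, B.form x v = B.form y v) : x = y := by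
  by_contra hne
  have := hB _ (sub_ne_zero.2 hne)
  rw [LinearMap.map_sub₂, h, sub_self] at this
  exact lt_irrefl _ this

theorem form_corootVec (i : ι) (v : V) : B.form (corootVec B i) v = P.coroot' i v := by
  rw [← form_root_eq_coroot' B, corootVec, map_smul, LinearMap.smul_apply, smul_eq_mul,
    form_comm B v, mul_comm]

/-- The simple coroots form a base of the dual root system; its integral expansions are carried to
`V` by the non-degenerate form. -/
theorem corootVec_mem_corootLattice (hB : ∀ x, x ≠ 0 → 0 < B.form x x) (b : P.Base) (i : ι) :
    corootVec B i ∈ corootLattice b B := by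
  obtain ⟨f, -, -, hf⟩ := b.flip.exists_root_eq_sum_int i
  have : corootVec B i = ∑ j ∈ b.support, f j • corootVec B j := by
    refine eq_of_forall_form_eq hB fun v ↦ ?_
    have hf' : P.coroot i = ∑ j ∈ b.support, f j • P.coroot j := hf
    have hv : ∀ j, P.coroot' j v = P.toLinearMap v (P.coroot j) := fun _ ↦ rfl
    simp only [map_sum, map_zsmul, LinearMap.sum_apply, LinearMap.smul_apply, form_corootVec, hv,
      hf']
  rw [this]
  exact sum_mem fun j hj ↦ zsmul_mem (AddSubgroup.subset_closure (Set.mem_image_of_mem _ hj)) _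

theorem apply_mem_corootLattice (hB : ∀ x, x ≠ 0 → 0 < B.form x x) (b : P.Base) {u : V ≃ₗ[ℝ] V}
    (hu : u ∈ linearWeylGroup P) {q : V} (hq : q ∈ corootLattice b B) :
    u q ∈ corootLattice b B := by
  have hrefl : ∀ i, ∀ q ∈ corootLattice b B, P.reflection i q ∈ corootLattice b B := by
    intro i q hq
    induction hq using AddSubgroup.closure_induction with
    | mem q hq =>
      obtain ⟨j, -, rfl⟩ := hq
      rw [reflection_corootVec]
      exact corootVec_mem_corootLattice hB b _
    | zero => rw [map_zero]; exact zero_mem _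
    | add x y _ _ hx hy => rw [map_add]; exact add_mem hx hy
    | neg x _ hx => rw [map_neg]; exact neg_mem hx
  refine Subgroup.closure_induction''
    (p := fun u _ ↦ ∀ q ∈ corootLattice b B, u q ∈ corootLattice b B) ?_ ?_ ?_ ?_ hu q hq
  · rintro _ ⟨i, rfl⟩
    exact hrefl i
  · rintro _ ⟨i, rfl⟩ q hq
    have : (P.reflection i)⁻¹ = P.reflection i := P.reflection_inv i
    rw [this]
    exact hrefl i q hq
  · exact fun q hq ↦ hq
  · exact fun u v _ _ hu hv q hq ↦ hu _ (hv _ hq)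

end Translations

/-! ### The coroot lattice modulo two. -/

section Parity

variable {ι V N : Type*} [AddCommGroup V] [Module ℝ V] [AddCommGroup N] [Module ℝ N]
  {P : RootPairing ι ℝ V N} {B : P.InvariantForm}

theorem exists_coeff_of_mem_corootLattice {b : P.Base} {z : V} (hz : z ∈ corootLattice b B) :
    ∃ m : b.support → ℤ, z = ∑ j, m j • corootVec B (j : ι) := by
  classical
  induction hz using AddSubgroup.closure_induction with
  | mem z hz =>
    obtain ⟨i, hi, rfl⟩ := hz
    refine ⟨Pi.single ⟨i, hi⟩ 1, ?_⟩
    rw [Finset.sum_eq_single_of_mem ⟨i, hi⟩ (Finset.mem_univ _)]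
    · simp
    · intro j _ hj; simp [hj]
  | zero => exact ⟨0, by simp⟩
  | add x y _ _ hx hy =>
    obtain ⟨m, rfl⟩ := hx
    obtain ⟨n, rfl⟩ := hy
    exact ⟨m + n, by simp [add_smul, Finset.sum_add_distrib]⟩
  | neg x _ hx =>
    obtain ⟨m, rfl⟩ := hx
    exact ⟨-m, by simp⟩

theorem sum_corootVec_mem_corootLattice (b : P.Base) (m : b.support → ℤ) :
    ∑ j, m j • corootVec B (j : ι) ∈ corootLattice b B :=
  sum_mem fun j _ ↦ zsmul_mem (AddSubgroup.subset_closure (Set.mem_image_of_mem _ j.2)) _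

theorem coeff_unique {b : P.Base} {m n : b.support → ℤ}
    (h : ∑ j, m j • corootVec B (j : ι) = ∑ j, n j • corootVec B (j : ι)) : m = n := by
  have hli := b.linearIndepOn_root
  rw [LinearIndepOn, Fintype.linearIndependent_iff] at hli
  funext i
  have h0 := hli (fun j ↦ ((m j - n j : ℤ) : ℝ) * (2 / B.form (P.root j) (P.root j))) (by
    have h1 : ∑ j : b.support, (m j - n j) • corootVec B (j : ι) = 0 := by
      simp only [sub_smul, Finset.sum_sub_distrib, h, sub_self]
    rw [← h1]
    refine Finset.sum_congr rfl fun j _ ↦ ?_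
    rw [corootVec, mul_smul, Int.cast_smul_eq_zsmul]) i
  have h2 := B.ne_zero (i : ι)
  have h3 : ((m i - n i : ℤ) : ℝ) = 0 := by
    rcases mul_eq_zero.1 h0 with h | h
    · exact h
    · exact absurd h (div_ne_zero two_ne_zero h2)
  have h4 : m i - n i = 0 := by exact_mod_cast h3
  omega

theorem oddSimpleRoots_sum (b : P.Base) (m : b.support → ℤ) :
    oddSimpleRoots b B (∑ j, m j • corootVec B (j : ι)) = {i | Odd (m i)} := by
  ext i
  constructor
  · rintro ⟨n, hn, hodd⟩
    rwa [← coeff_unique hn] at hodd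
  · intro h
    exact ⟨m, rfl, h⟩

/-- The simple coroots are a basis of the lattice, so the parities of the coefficients are precisely
the class modulo `2Q^∨`. -/
theorem oddSimpleRoots_eq_iff {b : P.Base} {z z' : V} (hz : z ∈ corootLattice b B)
    (hz' : z' ∈ corootLattice b B) :
    oddSimpleRoots b B z = oddSimpleRoots b B z' ↔ ∃ q ∈ corootLattice b B, z' = z + 2 • q := by
  obtain ⟨m, rfl⟩ := exists_coeff_of_mem_corootLattice hz
  obtain ⟨n, rfl⟩ := exists_coeff_of_mem_corootLattice hz'
  rw [oddSimpleRoots_sum, oddSimpleRoots_sum]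
  constructor
  · intro h
    have hpar : ∀ i, Even (n i - m i) := by
      intro i
      have : Odd (m i) ↔ Odd (n i) := Set.ext_iff.1 h i
      rw [Int.even_sub', this]
    choose c hc using hpar
    refine ⟨_, sum_corootVec_mem_corootLattice b c, ?_⟩
    rw [Finset.smul_sum, ← Finset.sum_add_distrib]
    refine Finset.sum_congr rfl fun j _ ↦ ?_
    rw [two_smul, ← add_smul, ← add_smul, ← hc]
    congr 1
    ring
  · rintro ⟨q, hq, h⟩
    obtain ⟨c, rfl⟩ := exists_coeff_of_mem_corootLattice hq
    have h1 : n = fun j ↦ m j + 2 * c j := by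
      refine coeff_unique (B := B) ?_
      rw [h, Finset.smul_sum, ← Finset.sum_add_distrib]
      refine Finset.sum_congr rfl fun j _ ↦ ?_
      rw [two_mul, add_smul, add_smul, two_smul]
    ext i
    simp only [Set.mem_ofPred_eq, h1, Int.odd_add, even_two_mul, iff_true]

end Parity

/-! ### Minuscule elements and classes modulo `2Q^∨`. -/

section MinusculeLattice

variable {ι V N : Type*} [AddCommGroup V] [Module ℝ V] [AddCommGroup N] [Module ℝ N]
  {P : RootPairing ι ℝ V N} {B : P.InvariantForm} (hB : ∀ x, x ≠ 0 → 0 < B.form x x)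
  [Finite ι] [Nonempty ι] [P.IsCrystallographic] [P.IsReduced] [P.IsRootSystem] [P.IsIrreducible]

include hB

theorem exists_actsBy {b : P.Base} {w : AffineSpace V ≃ₗ[ℝ] AffineSpace V}
    (hw : w ∈ affineWeylGroup b B) :
    ∃ u ∈ linearWeylGroup P, ∃ q ∈ corootLattice b B, ActsBy B w u q := by
  refine affineWeylGroup_induction hB (b := b)
    (p := fun w ↦ ∃ u ∈ linearWeylGroup P, ∃ q ∈ corootLattice b B, ActsBy B w u q)
    ⟨1, one_mem _, 0, zero_mem _, ActsBy.one⟩ ?_ hw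
  rintro s w ⟨a, ha, hs⟩ ⟨u, hu, q, hq, hact⟩
  obtain ⟨i, k, rfl⟩ := isAffineRoot_of_simple B hB ha
  refine ⟨P.reflection i * u, mul_mem (Subgroup.subset_closure ⟨i, rfl⟩) hu, _, ?_,
    hs.actsBy.mul hact hu⟩
  exact add_mem hq (apply_mem_corootLattice hB b (inv_mem hu)
    (zsmul_mem (corootVec_mem_corootLattice hB b i) _))

theorem exists_mem_actsBy_linear (b : P.Base) {u : V ≃ₗ[ℝ] V} (hu : u ∈ linearWeylGroup P) :
    ∃ w ∈ affineWeylGroup b B, ActsBy B w u 0 := by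
  induction hu using Subgroup.closure_induction with
  | mem u hu =>
    obtain ⟨i, rfl⟩ := hu
    obtain ⟨s, hs, hsr⟩ := exists_reflection_mem hB b (⟨i, 0, rfl⟩ : IsAffineRoot P _)
    exact ⟨s, hs, by simpa using hsr.actsBy⟩
  | one => exact ⟨1, one_mem _, ActsBy.one⟩
  | mul u v _ hv hu' hv' =>
    obtain ⟨w, hw, h⟩ := hu'
    obtain ⟨w', hw', h'⟩ := hv'
    exact ⟨w * w', mul_mem hw hw', by simpa using h.mul h' hv⟩
  | inv u hu hu' =>
    obtain ⟨w, hw, h⟩ := hu'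
    exact ⟨w⁻¹, inv_mem hw, by simpa using h.inv hu⟩

/-- The product of the reflections in `α` and `α - δ` is the translation by `α^∨`. -/
theorem exists_mem_actsBy_translation (b : P.Base) {q : V} (hq : q ∈ corootLattice b B) :
    ∃ w ∈ affineWeylGroup b B, ActsBy B w 1 q := by
  induction hq using AddSubgroup.closure_induction with
  | mem q hq =>
    obtain ⟨i, -, rfl⟩ := hq
    obtain ⟨s, hs, hsr⟩ := exists_reflection_mem hB b (⟨i, 0, rfl⟩ : IsAffineRoot P _)
    obtain ⟨r, hr, hrr⟩ := exists_reflection_mem hB b (⟨i, -1, rfl⟩ : IsAffineRoot P _)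
    refine ⟨s * r, mul_mem hs hr, ?_⟩
    have := hsr.actsBy.mul hrr.actsBy (Subgroup.subset_closure ⟨i, rfl⟩)
    have h2 : P.reflection i * P.reflection i = 1 := LinearEquiv.ext fun v ↦ by
      simp [LinearEquiv.mul_apply]
    rw [h2] at this
    simpa using this
  | zero => exact ⟨1, one_mem _, ActsBy.one⟩
  | add x y _ _ hx hy =>
    obtain ⟨w, hw, h⟩ := hx
    obtain ⟨w', hw', h'⟩ := hy
    refine ⟨w * w', mul_mem hw hw', ?_⟩
    simpa [add_comm] using h.mul h' (one_mem _)
  | neg x _ hx =>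
    obtain ⟨w, hw, h⟩ := hx
    exact ⟨w⁻¹, inv_mem hw, by simpa using h.inv (one_mem _)⟩

theorem exists_mem_actsBy (b : P.Base) {u : V ≃ₗ[ℝ] V} (hu : u ∈ linearWeylGroup P) {q : V}
    (hq : q ∈ corootLattice b B) : ∃ w ∈ affineWeylGroup b B, ActsBy B w u q := by
  obtain ⟨w, hw, h⟩ := exists_mem_actsBy_linear hB b hu
  obtain ⟨w', hw', h'⟩ := exists_mem_actsBy_translation hB b hq
  exact ⟨w * w', mul_mem hw hw', by simpa using h.mul h' (one_mem _)⟩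

/-- The level of `w⁻¹(α)` is `(q, α)`, and the simple roots are a basis; so the lattice element is
the translation part of `w⁻¹`. -/
theorem ActsBy.isLatticeElementOf_iff {b : P.Base} {w : AffineSpace V ≃ₗ[ℝ] AffineSpace V}
    (hw : w ∈ affineWeylGroup b B) {u : V ≃ₗ[ℝ] V} {q z : V} (hq : q ∈ corootLattice b B)
    (h : ActsBy B w⁻¹ u q) : IsLatticeElementOf b B w z ↔ z = q := by
  constructor
  · rintro ⟨-, hz⟩
    refine eq_of_forall_form_eq hB fun v ↦ ?_
    suffices B.form z = B.form q by rw [this]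
    refine b.toWeightBasis.ext fun i ↦ ?_
    obtain ⟨j, k, hw', hk⟩ := hz i i.2
    rw [h] at hw'
    simp only [Prod.mk.injEq, zero_add] at hw'
    rw [RootPairing.Base.toWeightBasis_apply, hk, hw'.2.1]
  · rintro rfl
    refine ⟨hq, fun i hi ↦ ?_⟩
    obtain ⟨j, k, hjk⟩ := isAffineRoot_apply_of_mem hB (inv_mem hw)
      (⟨i, 0, rfl⟩ : IsAffineRoot P (P.root i, ((0 : ℤ) : ℝ), 0))
    rw [Int.cast_zero] at hjk
    refine ⟨j, k, hjk, ?_⟩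
    rw [h] at hjk
    simp only [Prod.mk.injEq, zero_add] at hjk
    exact hjk.2.1

theorem existsUnique_isLatticeElementOf {b : P.Base} {w : AffineSpace V ≃ₗ[ℝ] AffineSpace V}
    (hw : w ∈ affineWeylGroup b B) : ∃! z, IsLatticeElementOf b B w z := by
  obtain ⟨u, -, q, hq, h⟩ := exists_actsBy hB (inv_mem hw)
  exact ⟨q, (h.isLatticeElementOf_iff hB hw hq).2 rfl,
    fun z hz ↦ (h.isLatticeElementOf_iff hB hw hq).1 hz⟩

theorem IsLatticeElementOf.exists_actsBy {b : P.Base}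
    {w : AffineSpace V ≃ₗ[ℝ] AffineSpace V} (hw : w ∈ affineWeylGroup b B) {z : V}
    (hz : IsLatticeElementOf b B w z) : ∃ u ∈ linearWeylGroup P, ActsBy B w⁻¹ u z := by
  obtain ⟨u, hu, q, hq, h⟩ := AbIdeal.exists_actsBy hB (inv_mem hw)
  obtain rfl := (h.isLatticeElementOf_iff hB hw hq).1 hz
  exact ⟨u, hu, h⟩

/-- Every class of the coroot lattice modulo `2` contains the lattice element of a minuscule
element. -/
theorem exists_isMinusculeWith_isLatticeElementOf (b : P.Base) {z : V}
    (hz : z ∈ corootLattice b B) :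
    ∃ C, IsAbelianSet b C ∧ ∃ w ∈ affineWeylGroup b B, IsMinusculeWith b w C ∧
      ∃ q ∈ corootLattice b B, IsLatticeElementOf b B w (z + 2 • q) := by
  obtain ⟨t, ht, htz⟩ := exists_mem_actsBy_translation hB b hz
  -- `D` doubles the level: it turns the condition for lying in `A` into that for lying in `2A`.
  let D : AffineSpace V →ₗ[ℝ] AffineSpace V :=
    LinearMap.prodMap LinearMap.id (LinearMap.prodMap ((2 : ℝ) • LinearMap.id) LinearMap.id)
  have hD : ∀ (v : V) (a : ℝ), D (v, a, 0) = (v, 2 * a, 0) := fun v a ↦ by simp [D]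
  obtain ⟨h, hh, hpos⟩ := exists_mem_forall_pos hB b (alcoveForm b ∘ₗ t⁻¹.toLinearMap ∘ₗ D)
    (by
      have : D (0, 1, 0) = (2 : ℝ) • (0, 1, 0) := by simp [hD]
      simp only [LinearMap.comp_apply, this, map_smul, LinearEquiv.coe_coe,
        apply_delta_of_mem hB (inv_mem ht)]
      exact smul_pos two_pos (alcoveForm_delta_pos b))
    (by
      rintro _ ⟨i, k, rfl⟩
      have : D (P.root i, (k : ℝ), 0) = (P.root i, ((2 * k : ℤ) : ℝ), 0) := by simp [hD]
      simp only [LinearMap.comp_apply, this, LinearEquiv.coe_coe]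
      exact alcoveForm_ne_zero (isAffineRoot_apply_of_mem hB (inv_mem ht) ⟨i, _, rfl⟩))
  obtain ⟨u, hu, q, hq, hact⟩ := exists_actsBy hB hh
  -- Doubling the translation part gives `D ∘ h = h₂ ∘ D` on `V ⊕ ℝδ`, so `t⁻¹h₂` keeps doubled
  -- positive roots positive.
  obtain ⟨h₂, hh₂, hact₂⟩ := exists_mem_actsBy hB b hu (nsmul_mem hq 2)
  have hw : t⁻¹ * h₂ ∈ affineWeylGroup b B := mul_mem (inv_mem ht) hh₂
  have heven : ∀ i (k : ℤ), ((P.root i, (k : ℝ), 0) : AffineSpace V) ∈ positiveAffineRoots b →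
      0 < alcoveForm b ((t⁻¹ * h₂) (P.root i, 2 * (k : ℝ), 0)) := by
    intro i k hk
    have h1 := hpos _ hk
    rw [hact] at h1
    rw [LinearEquiv.mul_apply, hact₂]
    simp only [LinearMap.comp_apply, LinearEquiv.coe_coe, hD] at h1
    convert h1 using 5
    rw [map_nsmul, LinearMap.smul_apply, nsmul_eq_mul]
    push_cast
    ring
  obtain ⟨C, hC, hwC⟩ := isAbelianSet_of_inversionSet hB hw (by
    rintro x ⟨hx, hneg⟩
    have hxr := isAffineRoot_of_pos hx
    rw [neg_mem_positiveAffineRoots_iff (isAffineRoot_apply_of_mem hB hw hxr),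
      mem_positiveAffineRoots_iff_alcoveForm (isAffineRoot_apply_of_mem hB hw hxr)] at hneg
    obtain ⟨i, k, rfl⟩ := hxr
    rw [mem_positiveAffineRoots_iff] at hx
    -- Even levels are doubles. At level `2m + 1` the root is a double plus `δ`, so it can be
    -- inverted only when `γ + mδ` is not positive, that is, `m = 0` and `γ` negative.
    obtain ⟨m, rfl | rfl⟩ := Int.even_or_odd' k
    · refine absurd ?_ hneg
      have := heven i m ((mem_positiveAffineRoots_iff b i m).2 (by
        rcases hx with hx | ⟨hx, hi⟩
        · left; omega
        · right; exact ⟨by omega, hi⟩))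
      push_cast
      exact this
    · by_cases hm : ((P.root i, (m : ℝ), 0) : AffineSpace V) ∈ positiveAffineRoots b
      · refine absurd ?_ hneg
        have h1 := heven i m hm
        have h2 : ((P.root i, ((2 * m + 1 : ℤ) : ℝ), 0) : AffineSpace V) =
            (P.root i, 2 * (m : ℝ), 0) + (0, 1, 0) := by ext <;> simp
        rw [h2, map_add, map_add, apply_delta_of_mem hB hw]
        exact add_pos h1 (alcoveForm_delta_pos b)
      · rw [mem_positiveAffineRoots_iff] at hm
        have hm0 : m = 0 := by
          rcases hx with hx | ⟨hx, hi⟩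
          · by_contra; exact hm (Or.inl (by omega))
          · omega
        have hi : ¬ b.IsPos i := fun hi ↦ hm (Or.inr ⟨hm0, hi⟩)
        refine ⟨P.reflectionPerm i i, ?_, by simp [hm0]⟩
        rw [isPos_iff_mem_posCone]
        simpa using neg_mem_posCone_of_not_isPos b hi)
  refine ⟨C, hC, _, hw, hwC, -u q, neg_mem (apply_mem_corootLattice hB b hu hq), ?_⟩
  have hinv : ActsBy B (t⁻¹ * h₂)⁻¹ (u⁻¹ * 1) (z + 2 • (-u q)) := by
    rw [mul_inv_rev, inv_inv]
    have := (hact₂.inv hu).mul htz (one_mem _)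
    simpa using this
  exact (hinv.isLatticeElementOf_iff hB hw (add_mem hz (nsmul_mem
    (neg_mem (apply_mem_corootLattice hB b hu hq)) 2))).2 rfl

/-- Minuscule elements whose lattice elements agree modulo `2` have the same set of roots. -/
theorem IsMinusculeWith.eq_of_isLatticeElementOf {b : P.Base}
    {w w' : AffineSpace V ≃ₗ[ℝ] AffineSpace V} (hw : w ∈ affineWeylGroup b B)
    (hw' : w' ∈ affineWeylGroup b B) {C C' : Set ι} (hC : IsMinusculeWith b w C)
    (hC' : IsMinusculeWith b w' C') {z q : V} (hq : q ∈ corootLattice b B)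
    (hz : IsLatticeElementOf b B w z) (hz' : IsLatticeElementOf b B w' (z + 2 • q)) : C = C' := by
  obtain ⟨u, hu, hact⟩ := hz.exists_actsBy hB hw
  obtain ⟨u', hu', hact'⟩ := hz'.exists_actsBy hB hw'
  have hg : ActsBy B (w⁻¹ * w') (u * u'⁻¹) (2 • -u' q) := by
    have := hact.mul (hact'.inv hu') (inv_mem hu')
    simpa [add_comm] using this
  -- `h` is `w⁻¹w'` with its translation part halved, which stays in `Q^∨` because `z` and `z'`
  -- agree modulo `2Q^∨`.
  obtain ⟨h, hh, hhact⟩ := exists_mem_actsBy hB b (mul_mem hu (inv_mem hu'))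
    (neg_mem (apply_mem_corootLattice hB b hu' hq))
  have heven : ∀ {w C}, w ∈ affineWeylGroup b B → IsMinusculeWith b w C → ∀ i (k : ℤ),
      ((P.root i, (k : ℝ), 0) : AffineSpace V) ∈ positiveAffineRoots b →
      w (P.root i, ((2 * k : ℤ) : ℝ), 0) ∈ positiveAffineRoots b := by
    intro w C hw hC i k hk
    refine hC.apply_mem hB hw ?_ ?_
    · rw [mem_positiveAffineRoots_iff] at hk ⊢
      rcases hk with hk | ⟨rfl, hi⟩
      · left; omega
      · right; exact ⟨rfl, hi⟩
    · intro j _ hj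
      simp only [Prod.mk.injEq] at hj
      have : 2 * k = 1 := by exact_mod_cast hj.2.1
      omega
  -- If `h x = -y` with `x` and `y` positive, doubling gives `w'(Dx) = -w(Dy)`, yet both images are
  -- positive.
  have hone : h = 1 := by
    refine eq_one_of_forall_pos hB hh fun x hx ↦ ?_
    by_contra hneg
    have hxr := isAffineRoot_of_pos hx
    rw [← neg_mem_positiveAffineRoots_iff (isAffineRoot_apply_of_mem hB hh hxr)] at hneg
    obtain ⟨i, k, rfl⟩ := hxr
    obtain ⟨j, m, hjm⟩ := isAffineRoot_of_pos hneg
    have h1 := heven hw' hC' i k hx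
    rw [hjm] at hneg
    have h2 := heven hw hC j m hneg
    have h3 : w' (P.root i, ((2 * k : ℤ) : ℝ), 0) = -w (P.root j, ((2 * m : ℤ) : ℝ), 0) := by
      have h4 : (w⁻¹ * w') (P.root i, ((2 * k : ℤ) : ℝ), 0) =
          -(P.root j, ((2 * m : ℤ) : ℝ), 0) := by
        rw [hhact] at hjm
        simp only [Prod.neg_mk, Prod.mk.injEq] at hjm
        rw [hg, Prod.neg_mk, ← hjm.1, neg_neg, Prod.neg_mk]
        have h5 : B.form (2 • -u' q) (P.root i) = 2 * B.form (-u' q) (P.root i) := by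
          rw [map_nsmul, LinearMap.smul_apply, nsmul_eq_mul]; norm_num
        rw [h5]
        push_cast
        rw [← hjm.2.1]
        ext <;> simp
        ring
      rw [← map_neg, ← h4, ← LinearEquiv.mul_apply, mul_inv_cancel_left]
    rw [h3, neg_mem_positiveAffineRoots_iff (isAffineRoot_of_pos h2)] at h1
    exact h1 h2
  have hsame : ∀ (v : V) (a : ℝ), w' (v, a, 0) = w (v, a, 0) := by
    intro v a
    have h1 := hhact v a
    rw [hone] at h1
    simp only [LinearEquiv.coe_one, id_eq, Prod.mk.injEq, and_true] at h1
    have h2 : (w⁻¹ * w') (v, a, 0) = (v, a, 0) := by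
      rw [hg, ← h1.1, map_nsmul, LinearMap.smul_apply]
      have : B.form (-u' q) v = 0 := by linarith [h1.2]
      rw [this]; simp
    calc w' (v, a, 0) = w ((w⁻¹ * w') (v, a, 0)) := by
          rw [← LinearEquiv.mul_apply, mul_inv_cancel_left]
      _ = w (v, a, 0) := by rw [h2]
  have hinv : inversionSet b w' = inversionSet b w := by
    ext x
    refine and_congr_right fun hx ↦ ?_
    obtain ⟨i, k, rfl⟩ := isAffineRoot_of_pos hx
    rw [hsame]
  refine hC.unique (C' := C') ?_
  rw [IsMinusculeWith, ← hinv]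
  exact hC'

theorem minusculeElement_spec {b : P.Base} {C : Set ι} (hC : IsAbelianSet b C) :
    IsMinusculeWith b (minusculeElement b B C : AffineSpace V ≃ₗ[ℝ] AffineSpace V) C := by
  obtain ⟨w, hw, hwC⟩ := hC.exists_isMinusculeWith hB
  exact Classical.epsilon_spec
    (p := fun w : affineWeylGroup b B ↦
      IsMinusculeWith b (w : AffineSpace V ≃ₗ[ℝ] AffineSpace V) C) ⟨⟨w, hw⟩, hwC⟩

theorem latticeElement_spec (b : P.Base) (C : Set ι) :
    IsLatticeElementOf b B (minusculeElement b B C : AffineSpace V ≃ₗ[ℝ] AffineSpace V)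
      (latticeElement b B C) :=
  Classical.epsilon_spec
    (existsUnique_isLatticeElementOf hB (minusculeElement b B C).2).exists

theorem oddSimpleRoots_latticeElement_injOn (b : P.Base) :
    Set.InjOn (fun C ↦ oddSimpleRoots b B (latticeElement b B C)) {C | IsAbelianSet b C} := by
  intro C hC C' hC' h
  obtain ⟨q, hq, hqz⟩ := (oddSimpleRoots_eq_iff (latticeElement_spec hB b C).1
    (latticeElement_spec hB b C').1).1 h
  refine (minusculeElement_spec hB hC).eq_of_isLatticeElementOf hB (minusculeElement b B C).2
    (minusculeElement b B C').2 (minusculeElement_spec hB hC') hq (latticeElement_spec hB b C) ?_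
  rw [← hqz]
  exact latticeElement_spec hB b C'

theorem oddSimpleRoots_latticeElement_surjOn (b : P.Base) (S : Set b.support) :
    ∃ C, IsAbelianSet b C ∧ oddSimpleRoots b B (latticeElement b B C) = S := by
  classical
  let m : b.support → ℤ := fun i ↦ if i ∈ S then 1 else 0
  have hm : oddSimpleRoots b B (∑ j, m j • corootVec B (j : ι)) = S := by
    rw [oddSimpleRoots_sum]
    ext i
    by_cases hi : i ∈ S <;> simp [m, hi]
  have hz := sum_corootVec_mem_corootLattice (B := B) b m
  obtain ⟨C, hC, w, hw, hwC, q, hq, hwq⟩ := exists_isMinusculeWith_isLatticeElementOf hB b hz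
  refine ⟨C, hC, ?_⟩
  have h1 : w = (minusculeElement b B C : AffineSpace V ≃ₗ[ℝ] AffineSpace V) :=
    eq_of_inversionSet_eq hB hw (minusculeElement b B C).2
      (hwC.trans (minusculeElement_spec hB hC).symm)
  rw [h1] at hwq
  have h2 := (existsUnique_isLatticeElementOf hB (minusculeElement b B C).2).unique hwq
    (latticeElement_spec hB b C)
  rw [← h2, ← hm, eq_comm, oddSimpleRoots_eq_iff hz hwq.1]
  exact ⟨q, hq, rfl⟩

end MinusculeLattice

/-! ### The real root system of a simple Lie algebra. -/

section RealRootSystem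

variable {𝔤 : Type*} [LieRing 𝔤] [LieAlgebra ℂ 𝔤] [FiniteDimensional ℂ 𝔤]
  [LieAlgebra.IsSimple ℂ 𝔤] (H : LieSubalgebra ℂ 𝔤) [H.IsCartanSubalgebra]

theorem realRootSystem_root_eq_add_iff {i j k : H.root} :
    (realRootSystem H).root k = (realRootSystem H).root i + (realRootSystem H).root j ↔
      ((k.1 : LieModule.Weight ℂ H 𝔤) : H → ℂ) = i.1 + j.1 := by
  constructor
  · intro h
    funext x
    have := congrArg (fun y : (rootSystem H).rootSpan ℝ ↦ (y : Module.Dual ℂ H) x) h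
    exact this
  · intro h
    exact Subtype.ext (LinearMap.ext fun x ↦ congrFun h x)

instance : Nonempty H.root := by
  by_contra h
  have := RootPairing.IsIrreducible.nontrivial (rootSystem H)
  have h1 := RootPairing.IsRootSystem.span_root_eq_top (P := rootSystem H)
  rw [not_nonempty_iff] at h
  rw [Set.range_eq_empty, Submodule.span_empty] at h1
  exact bot_ne_top h1

theorem ofReal_pairing (i j : H.root) :
    (((realRootSystem H).pairing i j : ℝ) : ℂ) = (rootSystem H).pairing i j := by
  have := RootPairing.IsValuedIn.trans (rootSystem H) ℝ ℤ
  exact (rootSystem H).restrictScalars_pairing ℝ i j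

theorem realRootSystem_pairing_eq_zero_iff (i j : H.root) :
    (realRootSystem H).pairing i j = 0 ↔ (rootSystem H).pairing i j = 0 := by
  rw [← ofReal_pairing, Complex.ofReal_eq_zero]

instance : (realRootSystem H).IsCrystallographic where
  exists_value i j := by
    refine ⟨(rootSystem H).pairingIn ℤ i j, ?_⟩
    have h := (rootSystem H).algebraMap_pairingIn ℤ i j
    rw [← ofReal_pairing] at h
    simp only [algebraMap_int_eq, eq_intCast] at h ⊢
    exact_mod_cast h

instance : (realRootSystem H).IsReduced where
  eq_or_eq_neg i j h := by
    have h' : ¬ LinearIndependent ℂ ![(rootSystem H).root i, (rootSystem H).root j] := by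
      rw [LinearIndependent.pair_iff' ((realRootSystem H).ne_zero i)] at h
      rw [LinearIndependent.pair_iff' ((rootSystem H).ne_zero i)]
      push Not at h ⊢
      obtain ⟨a, ha⟩ := h
      exact ⟨a, congrArg (fun y : (rootSystem H).rootSpan ℝ ↦ (y : Module.Dual ℂ H)) ha⟩
    rcases RootPairing.IsReduced.eq_or_eq_neg (P := rootSystem H) i j h' with h | h
    · exact Or.inl (Subtype.ext h)
    · exact Or.inr (Subtype.ext h)

/-- An invariant real subspace splits the roots into two orthogonal sets. Orthogonality only
involves pairings, which agree over `ℝ` and `ℂ`, so irreducibility of the complex system makes one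
set span everything; a coroot from the other would then kill its own root. -/
instance : (realRootSystem H).IsIrreducible := by
  have hne : Nontrivial ((rootSystem H).rootSpan ℝ) := by
    obtain ⟨i⟩ := (inferInstance : Nonempty H.root)
    exact ⟨(realRootSystem H).root i, 0, (realRootSystem H).ne_zero i⟩
  refine RootPairing.IsIrreducible.mk' _ fun q hq h0 ↦ ?_
  refine RootPairing.eq_top_of_mem_invtSubmodule_of_forall_eq_univ _ q h0 hq fun Φ hΦ hΦq hker ↦ ?_
  have horth : ∀ j ∉ Φ, ∀ i ∈ Φ, (rootSystem H).pairing i j = 0 := by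
    intro j hj i hi
    rw [← realRootSystem_pairing_eq_zero_iff]
    have := hker j hj (hΦq (Set.mem_image_of_mem _ hi))
    simpa using this
  have htop := (rootSystem H).span_root_image_eq_top_of_forall_orthogonal Φ hΦ (by
    intro j hj i hi
    have hjΦ : j ∉ Φ := fun h ↦ hj (Submodule.subset_span (Set.mem_image_of_mem _ h))
    have h1 := horth j hjΦ i hi
    exact ⟨(rootSystem H).pairing_eq_zero_iff.1 h1, h1⟩)
  by_contra hne
  obtain ⟨j, hj⟩ := (Set.ne_univ_iff_exists_notMem _).1 hne
  have : Submodule.span ℂ ((rootSystem H).root '' Φ) ≤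
      LinearMap.ker ((rootSystem H).coroot' j) := by
    refine Submodule.span_le.2 ?_
    rintro _ ⟨i, hi, rfl⟩
    simpa using horth j hj i hi
  rw [htop] at this
  have h2 := this (Submodule.mem_top (x := (rootSystem H).root j))
  rw [LinearMap.mem_ker, RootPairing.root_coroot'_eq_pairing, RootPairing.pairing_same] at h2
  exact two_ne_zero h2

end RealRootSystem

/-! ### Brackets of root spaces. -/

section RootSpaces

variable {𝔤 : Type*} [LieRing 𝔤] [LieAlgebra ℂ 𝔤] [FiniteDimensional ℂ 𝔤]
  [LieAlgebra.IsSimple ℂ 𝔤] {H : LieSubalgebra ℂ 𝔤} [H.IsCartanSubalgebra]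

open LieModule in
/-- If the sum of two roots is a root, then the bracket of their root spaces does not vanish. -/
theorem exists_lie_ne_zero {α β : Weight ℂ H 𝔤} (hα : α.IsNonZero)
    (h : rootSpace H (α + β : H → ℂ) ≠ ⊥) :
    ∃ x ∈ rootSpace H α, ∃ y ∈ rootSpace H β, ⁅x, y⁆ ≠ 0 := by
  obtain ⟨x, hx, x_ne0⟩ := (chainTop α β).exists_ne_zero
  obtain ⟨h', e, f, isSl2, he, hf⟩ := exists_isSl2Triple_of_weight_isNonZero hα
  obtain rfl := isSl2.h_eq_coroot hα he hf
  have prim : isSl2.HasPrimitiveVectorWith x (chainLength α β : ℂ) :=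
    have := lie_mem_genWeightSpace_of_mem_genWeightSpace he hx
    ⟨x_ne0, (chainLength_smul _ _ hx).symm, by rwa [genWeightSpace_add_chainTop _ _ hα] at this⟩
  have htop : 1 ≤ chainTopCoeff α β := by
    have := ((rootSpace_zsmul_add_ne_bot_iff α β hα 1).1 (by rwa [one_smul])).1
    exact_mod_cast this
  have hle := chainTopCoeff_le_chainLength α β
  obtain ⟨n, hn⟩ := Nat.exists_eq_add_of_le' htop
  -- Descend from the top of the `α`-string to `β` in `n + 1` steps. The `sl₂` relation then gives
  -- `e f^(n+1) x = (n+1)(ℓ - n) f^n x` with `n < ℓ`, the length of the string.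
  refine ⟨e, he, (toEnd ℂ 𝔤 𝔤 f ^ (n + 1)) x, ?_, ?_⟩
  · have h1 := toEnd_pow_apply_mem hf hx (n + 1)
    have h2 : (n + 1) • (-α : H → ℂ) + chainTop α β = β := by
      rw [coe_chainTop', hn, smul_neg]; abel
    rwa [h2] at h1
  · rw [prim.lie_e_pow_succ_toEnd_f]
    refine smul_ne_zero (mul_ne_zero (Nat.cast_add_one_ne_zero n) ?_)
      (prim.pow_toEnd_f_ne_zero_of_eq_nat rfl (by omega))
    rw [sub_ne_zero]
    exact_mod_cast (show chainLength α β ≠ n by omega)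

/-- A subspace which meets a root space non-trivially contains it. -/
theorem rootSpace_le_of_mem (i : H.root) {p : Submodule ℂ 𝔤} {x : 𝔤} (hx : x ∈ rootSpace H i.1)
    (hp : x ∈ p) (h0 : x ≠ 0) : (rootSpace H i.1).toSubmodule ≤ p := by
  have h1 := finrank_rootSpace_eq_one i.1 (H.isNonZero_coe_root i)
  intro y hy
  obtain ⟨c, hc⟩ := (finrank_eq_one_iff_of_nonzero' (⟨x, hx⟩ : rootSpace H i.1)
    (by simpa using h0)).1 h1 ⟨y, hy⟩
  have : y = c • x := by simpa using (congrArg Subtype.val hc).symm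
  rw [this]
  exact p.smul_mem c hp

end RootSpaces

/-! ### Abelian ideals and abelian sets of roots. -/

section Ideals

variable {𝔤 : Type*} [LieRing 𝔤] [LieAlgebra ℂ 𝔤] [FiniteDimensional ℂ 𝔤]
  [LieAlgebra.IsSimple ℂ 𝔤] {H : LieSubalgebra ℂ 𝔤} [H.IsCartanSubalgebra]
  {b : (realRootSystem H).Base}

theorem cartan_le_borel : H.toSubmodule ≤ (borel b).toSubmodule := le_sup_left

theorem rootSpace_le_borel {i : H.root} (hi : b.IsPos i) :
    (rootSpace H i.1).toSubmodule ≤ (borel b).toSubmodule :=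
  le_sup_of_le_right (le_iSup₂_of_le i hi le_rfl)

theorem exists_root_add {i j : H.root} (hi : b.IsPos i) (hj : b.IsPos j)
    (h : rootSpace H ((i.1 : H → ℂ) + j.1) ≠ ⊥) :
    ∃ k, (realRootSystem H).root k = (realRootSystem H).root i + (realRootSystem H).root j := by
  let χ : LieModule.Weight ℂ H 𝔤 := ⟨(i.1 : H → ℂ) + j.1, h⟩
  have hχ : χ.IsNonZero := by
    intro h0
    have h0 : (i.1 : H → ℂ) + j.1 = 0 := h0
    have h1 : (realRootSystem H).root i + (realRootSystem H).root j = 0 :=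
      Subtype.ext (LinearMap.ext fun x ↦ congrFun h0 x)
    rw [isPos_iff_heightForm] at hi hj
    have h2 := congrArg (heightForm b) h1
    rw [map_add, map_zero] at h2
    linarith
  exact ⟨⟨χ, by simpa using hχ⟩, (realRootSystem_root_eq_add_iff H).2 rfl⟩

omit [LieAlgebra.IsSimple ℂ 𝔤] in
theorem disjoint_rootSpace_biSup (i : H.root) {S : Set (H → ℂ)} (hS : (i.1 : H → ℂ) ∉ S) :
    Disjoint (rootSpace H i.1).toSubmodule (⨆ ψ ∈ S, (rootSpace H ψ).toSubmodule) :=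
  (LieSubmodule.iSupIndep_toSubmodule.2
    (LieModule.iSupIndep_genWeightSpace ℂ H 𝔤)).disjoint_biSup hS

omit [LieAlgebra.IsSimple ℂ 𝔤] in
theorem rootSpace_toSubmodule_ne_bot (i : H.root) : (rootSpace H i.1).toSubmodule ≠ ⊥ := by
  have := i.1.genWeightSpace_ne_bot
  simpa using this

theorem disjoint_rootSpace_borel {i : H.root} (hi : ¬ b.IsPos i) :
    Disjoint (rootSpace H i.1).toSubmodule (borel b).toSubmodule := by
  refine (disjoint_rootSpace_biSup i (S := {ψ | ψ ≠ i.1}) (by simp)).mono_right ?_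
  refine sup_le ?_ (iSup₂_le fun j hj ↦ ?_)
  · refine le_iSup₂_of_le (0 : H → ℂ) ?_ ?_
    · intro h
      exact H.isNonZero_coe_root i h.symm
    · intro x hx
      simpa using hx
  · refine le_iSup₂_of_le (j.1 : H → ℂ) ?_ le_rfl
    intro h
    have : j = i := Subtype.ext (DFunLike.coe_injective h)
    exact hi (this ▸ hj)

/-- An ideal of the Borel subalgebra, as a subspace of the whole Lie algebra. -/
noncomputable def idealSubmodule (I : LieIdeal ℂ (borel b)) : Submodule ℂ 𝔤 :=
  I.toSubmodule.map (borel b).toSubmodule.subtype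

theorem mem_idealSubmodule {I : LieIdeal ℂ (borel b)} {x : 𝔤} :
    x ∈ idealSubmodule I ↔ ∃ h : x ∈ borel b, (⟨x, h⟩ : borel b) ∈ I := by
  constructor
  · rintro ⟨y, hy, rfl⟩
    exact ⟨y.2, hy⟩
  · rintro ⟨h, hx⟩
    exact ⟨⟨x, h⟩, hx, rfl⟩

theorem idealSubmodule_injective :
    Function.Injective (idealSubmodule : LieIdeal ℂ (borel b) → Submodule ℂ 𝔤) := by
  intro I J h
  refine LieSubmodule.toSubmodule_injective ?_
  exact Submodule.map_injective_of_injective (Submodule.subtype_injective _) h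

theorem lie_mem_idealSubmodule {I : LieIdeal ℂ (borel b)} {u x : 𝔤} (hu : u ∈ borel b)
    (hx : x ∈ idealSubmodule I) : ⁅u, x⁆ ∈ idealSubmodule I := by
  obtain ⟨h, hx⟩ := mem_idealSubmodule.1 hx
  have h1 : ⁅(⟨u, hu⟩ : borel b), (⟨x, h⟩ : borel b)⁆ ∈ I := lie_mem_right ℂ (borel b) I _ _ hx
  exact ⟨_, h1, rfl⟩

theorem lie_eq_zero_of_mem_idealSubmodule {I : LieIdeal ℂ (borel b)} (hI : IsLieAbelian I)
    {x y : 𝔤} (hx : x ∈ idealSubmodule I) (hy : y ∈ idealSubmodule I) : ⁅x, y⁆ = 0 := by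
  obtain ⟨h, hx⟩ := mem_idealSubmodule.1 hx
  obtain ⟨h', hy⟩ := mem_idealSubmodule.1 hy
  have := hI.trivial ⟨_, hx⟩ ⟨_, hy⟩
  exact congrArg (fun z : I ↦ ((z : borel b) : 𝔤)) this

/-- When a sum of two roots is a root, some bracket of their root spaces is non-zero. As root spaces
are lines, this bracket puts the whole sum root space in the ideal, or contradicts commutativity. -/
theorem isAbelianSet_rootsOf {I : LieIdeal ℂ (borel b)} (hI : IsLieAbelian I) :
    IsAbelianSet b (rootsOf b I) := by
  have key : ∀ i j k : H.root,
      (realRootSystem H).root k = (realRootSystem H).root i + (realRootSystem H).root j →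
      ∃ x ∈ rootSpace H j.1, ∃ y ∈ rootSpace H i.1, ⁅x, y⁆ ≠ 0 ∧ ⁅x, y⁆ ∈ rootSpace H k.1 := by
    intro i j k hk
    have hk' : (k.1 : H → ℂ) = j.1 + i.1 := by
      rw [add_comm]; exact (realRootSystem_root_eq_add_iff H).1 hk
    obtain ⟨x, hx, y, hy, hxy⟩ := exists_lie_ne_zero (H.isNonZero_coe_root j) (β := i.1)
      (by rw [← hk']; exact k.1.genWeightSpace_ne_bot)
    refine ⟨x, hx, y, hy, hxy, ?_⟩
    rw [hk']
    exact lie_mem_genWeightSpace_of_mem_genWeightSpace hx hy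
  refine ⟨fun i hi ↦ hi.1, fun i hi j hj k hk ↦ ⟨hi.1.add hj hk, ?_⟩, fun i hi j hj k hk ↦ ?_⟩
  · obtain ⟨x, hx, y, hy, h0, hmem⟩ := key i j k hk
    exact rootSpace_le_of_mem k hmem
      (lie_mem_idealSubmodule (rootSpace_le_borel hj hx) (hi.2 hy)) h0
  · obtain ⟨x, hx, y, hy, h0, -⟩ := key i j k hk
    exact h0 (lie_eq_zero_of_mem_idealSubmodule hI (hj.2 hx) (hi.2 hy))

/-- If a positive root has `γ(x) ≠ 0`, then `[x, y] = γ(x)y` puts the root vector `y` in the ideal,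
where it must commute with `x`. So every root vanishes at `x`, and the roots span the dual of `H`.
-/
theorem eq_zero_of_mem_cartan_of_mem_idealSubmodule {I : LieIdeal ℂ (borel b)}
    (hI : IsLieAbelian I) {x : 𝔤} (hxH : x ∈ H) (hx : x ∈ idealSubmodule I) : x = 0 := by
  have hpos : ∀ i : H.root, b.IsPos i → i.1 ⟨x, hxH⟩ = 0 := by
    intro i hi
    by_contra h0
    obtain ⟨y, hy, hy0⟩ := i.1.exists_ne_zero
    have h1 : ⁅x, y⁆ = i.1 ⟨x, hxH⟩ • y := lie_eq_smul_of_mem_rootSpace hy ⟨x, hxH⟩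
    have h2 : ⁅x, y⁆ ∈ idealSubmodule I := by
      rw [← lie_skew]
      exact neg_mem (lie_mem_idealSubmodule (rootSpace_le_borel hi hy) hx)
    have h3 : y ∈ idealSubmodule I := by
      rw [h1] at h2
      exact ((idealSubmodule I).smul_mem_iff h0).1 h2
    have h4 := lie_eq_zero_of_mem_idealSubmodule hI hx h3
    rw [h1, smul_eq_zero] at h4
    exact h4.elim h0 hy0
  have hall : ∀ i : H.root, (rootSystem H).root i ⟨x, hxH⟩ = 0 := by
    intro i
    by_cases hi : b.IsPos i
    · exact hpos i hi
    · have h1 : b.IsPos ((realRootSystem H).reflectionPerm i i) := by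
        rw [isPos_iff_mem_posCone]
        simpa using neg_mem_posCone_of_not_isPos b hi
      have h2 := hpos _ h1
      have h3 : (rootSystem H).root ((rootSystem H).reflectionPerm i i) =
          -(rootSystem H).root i := by simp only [RootPairing.root_reflectionPerm,
            RootPairing.reflection_apply_self]
      have h4 := congrArg (fun f : Module.Dual ℂ H ↦ f ⟨x, hxH⟩) h3
      have h5 : (rootSystem H).root ((rootSystem H).reflectionPerm i i) ⟨x, hxH⟩ = 0 := h2
      simp only [h5, LinearMap.neg_apply] at h4
      simpa using h4.symm
  have hzero : ∀ f : Module.Dual ℂ H, f ⟨x, hxH⟩ = 0 := by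
    intro f
    have hf : f ∈ Submodule.span ℂ (Set.range (rootSystem H).root) := by
      rw [RootPairing.IsRootSystem.span_root_eq_top]; trivial
    induction hf using Submodule.span_induction with
    | mem f hf => obtain ⟨i, rfl⟩ := hf; exact hall i
    | zero => rfl
    | add f g _ _ hf hg => rw [LinearMap.add_apply, hf, hg, add_zero]
    | smul c f _ hf => rw [LinearMap.smul_apply, hf, smul_zero]
  exact congrArg Subtype.val ((Module.forall_dual_apply_eq_zero_iff ℂ (⟨x, hxH⟩ : H)).1 hzero)

/-- An abelian ideal of the Borel subalgebra is the sum of its root spaces. -/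
theorem idealSubmodule_eq_biSup {I : LieIdeal ℂ (borel b)} (hI : IsLieAbelian I) :
    idealSubmodule I = ⨆ i ∈ rootsOf b I, (rootSpace H i.1).toSubmodule := by
  refine le_antisymm ?_ (iSup₂_le fun i hi ↦ hi.2)
  -- The Borel subalgebra contains `H`, so the ideal is stable under `H` and is the sum of its
  -- intersections with the weight spaces.
  let M : LieSubmodule ℂ H 𝔤 :=
    { idealSubmodule I with
      lie_mem := fun {h x} hx ↦ lie_mem_idealSubmodule (cartan_le_borel h.2) hx }
  have hM : M.toSubmodule = idealSubmodule I := rfl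
  have hdec := congrArg LieSubmodule.toSubmodule (LieModule.eq_iSup_inf_genWeightSpace ℂ H 𝔤 M)
  rw [← hM, hdec, LieSubmodule.iSup_toSubmodule]
  refine iSup_le fun χ x hx ↦ ?_
  obtain ⟨hxM, hxχ⟩ : x ∈ M ∧ x ∈ rootSpace H χ := hx
  by_cases hx0 : x = 0
  · rw [hx0]; exact zero_mem _
  by_cases hχ : χ.IsZero
  · refine absurd (eq_zero_of_mem_cartan_of_mem_idealSubmodule hI ?_ hxM) hx0
    rw [hχ.eq] at hxχ
    simpa using hxχ
  · let i : H.root := ⟨χ, by simpa using hχ⟩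
    have hi : b.IsPos i := by
      by_contra hi
      exact hx0 ((Submodule.disjoint_def.1 (disjoint_rootSpace_borel hi)) x hxχ
        (mem_idealSubmodule.1 hxM).1)
    exact (le_iSup₂_of_le (f := fun (i : H.root) (_ : i ∈ rootsOf b I) ↦
      (rootSpace H i.1).toSubmodule) i ⟨hi, rootSpace_le_of_mem i hxχ hxM hx0⟩ le_rfl) hxχ

theorem rootsOf_injective : Function.Injective fun I : Ab b ↦ rootsOf b I.1 := by
  intro I J h
  refine Subtype.ext (idealSubmodule_injective ?_)
  have h : rootsOf b I.1 = rootsOf b J.1 := h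
  rw [idealSubmodule_eq_biSup I.2, idealSubmodule_eq_biSup J.2, h]

/-- Every abelian set of positive roots belongs to an abelian ideal. -/
theorem IsAbelianSet.exists_rootsOf_eq {C : Set H.root} (hC : IsAbelianSet b C) :
    ∃ I : Ab b, rootsOf b I.1 = C := by
  let M : Submodule ℂ 𝔤 := ⨆ i ∈ C, (rootSpace H i.1).toSubmodule
  have hroot : ∀ i ∈ C, (rootSpace H i.1).toSubmodule ≤ M := fun i hi ↦
    le_iSup₂_of_le (f := fun (i : H.root) (_ : i ∈ C) ↦ (rootSpace H i.1).toSubmodule) i hi le_rfl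
  have hMb : M ≤ (borel b).toSubmodule :=
    iSup₂_le fun i hi ↦ rootSpace_le_borel (hC.isPos i hi)
  have hlie : ∀ u ∈ borel b, ∀ x ∈ M, ⁅u, x⁆ ∈ M := by
    intro u hu x hx
    suffices M ≤ M.comap (LieModule.toEnd ℂ 𝔤 𝔤 u) from this hx
    refine iSup₂_le fun i hi y hy ↦ ?_
    suffices (borel b).toSubmodule ≤
        M.comap ((LieModule.toEnd ℂ 𝔤 𝔤 : 𝔤 →ₗ[ℂ] Module.End ℂ 𝔤).flip y) from this hu
    refine sup_le (fun h hh ↦ ?_) (iSup₂_le fun j hj v hv ↦ ?_)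
    · exact hroot i hi ((rootSpace H i.1).lie_mem (x := (⟨h, hh⟩ : H)) hy)
    · change ⁅v, y⁆ ∈ M
      have hvy : ⁅v, y⁆ ∈ rootSpace H ((i.1 : H → ℂ) + j.1) := by
        rw [add_comm]
        exact lie_mem_genWeightSpace_of_mem_genWeightSpace hv hy
      by_cases hbot : rootSpace H ((i.1 : H → ℂ) + j.1) = ⊥
      · rw [hbot, LieSubmodule.mem_bot] at hvy
        rw [hvy]; exact zero_mem _
      · obtain ⟨k, hk⟩ := exists_root_add (hC.isPos i hi) hj hbot
        rw [← (realRootSystem_root_eq_add_iff H).1 hk] at hvy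
        exact hroot k (hC.add_mem i hi j hj k hk) hvy
  have habel : ∀ x ∈ M, ∀ y ∈ M, ⁅x, y⁆ = 0 := by
    intro x hx y hy
    suffices M ≤ LinearMap.ker (LieModule.toEnd ℂ 𝔤 𝔤 x) from this hy
    refine iSup₂_le fun i hi y hy ↦ ?_
    suffices M ≤ LinearMap.ker ((LieModule.toEnd ℂ 𝔤 𝔤 : 𝔤 →ₗ[ℂ] Module.End ℂ 𝔤).flip y) from
      this hx
    refine iSup₂_le fun j hj x hx ↦ ?_
    change ⁅x, y⁆ = 0
    have hxy : ⁅x, y⁆ ∈ rootSpace H ((j.1 : H → ℂ) + i.1) :=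
      lie_mem_genWeightSpace_of_mem_genWeightSpace hx hy
    by_cases hbot : rootSpace H ((j.1 : H → ℂ) + i.1) = ⊥
    · rwa [hbot, LieSubmodule.mem_bot] at hxy
    · obtain ⟨k, hk⟩ := exists_root_add (hC.isPos j hj) (hC.isPos i hi) hbot
      exact absurd hk (hC.add_ne j hj i hi k)
  let I : LieIdeal ℂ (borel b) :=
    { M.comap (borel b).toSubmodule.subtype with
      lie_mem := fun {u x} hx ↦ hlie u u.2 x hx }
  have hIM : idealSubmodule I = M := by
    have : I.toSubmodule = M.comap (borel b).toSubmodule.subtype := rfl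
    rw [idealSubmodule, this, Submodule.map_comap_subtype, inf_eq_right]
    exact hMb
  have hIab : IsLieAbelian I := ⟨fun x y ↦ Subtype.ext (Subtype.ext (habel _ x.2 _ y.2))⟩
  refine ⟨⟨I, hIab⟩, Set.ext fun i ↦ ⟨fun hi ↦ ?_, fun hi ↦ ⟨hC.isPos i hi, ?_⟩⟩⟩
  · by_contra hiC
    have h1 : (rootSpace H i.1).toSubmodule ≤ M := hIM ▸ hi.2
    have h2 : Disjoint (rootSpace H i.1).toSubmodule M := by
      refine (disjoint_rootSpace_biSup i (S := {ψ | ψ ≠ i.1}) (by simp)).mono_right ?_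
      refine iSup₂_le fun j hj ↦ le_iSup₂_of_le (j.1 : H → ℂ) ?_ le_rfl
      intro h
      have : j = i := Subtype.ext (DFunLike.coe_injective h)
      exact hiC (this ▸ hj)
    exact rootSpace_toSubmodule_ne_bot i (h2.eq_bot_of_le h1)
  · have := hroot i hi
    rwa [← hIM] at this

end Ideals

end AbIdeal

theorem theorem3p1 {𝔤 : Type*} [LieRing 𝔤] [LieAlgebra ℂ 𝔤] [FiniteDimensional ℂ 𝔤]
    [LieAlgebra.IsSimple ℂ 𝔤] (H : LieSubalgebra ℂ 𝔤) [H.IsCartanSubalgebra]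
    (b : (AbIdeal.realRootSystem H).Base)
    (B : (AbIdeal.realRootSystem H).InvariantForm)
    (hB : ∀ x, x ≠ 0 → 0 < B.form x x) :
    (∀ I : AbIdeal.Ab b, ∃! w, w ∈ AbIdeal.affineWeylGroup b B ∧
      AbIdeal.IsMinusculeWith b w (AbIdeal.rootsOf b I.1)) ∧
    (∀ w ∈ AbIdeal.affineWeylGroup b B, ∃! z, AbIdeal.IsLatticeElementOf b B w z) ∧
    Function.Bijective (AbIdeal.oddSet b B : AbIdeal.Ab b → Set b.support) := by
  refine ⟨fun I ↦ ?_, fun w hw ↦ AbIdeal.existsUnique_isLatticeElementOf hB hw, ?_, fun S ↦ ?_⟩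
  · obtain ⟨w, hw, hwI⟩ := (AbIdeal.isAbelianSet_rootsOf I.2).exists_isMinusculeWith hB
    exact ⟨w, ⟨hw, hwI⟩, fun w' h ↦
      AbIdeal.eq_of_inversionSet_eq hB h.1 hw (h.2.trans hwI.symm)⟩
  · intro I J h
    exact AbIdeal.rootsOf_injective (AbIdeal.oddSimpleRoots_latticeElement_injOn hB b
      (AbIdeal.isAbelianSet_rootsOf I.2) (AbIdeal.isAbelianSet_rootsOf J.2) h)
  · obtain ⟨C, hC, hS⟩ := AbIdeal.oddSimpleRoots_latticeElement_surjOn hB b S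
    obtain ⟨I, rfl⟩ := hC.exists_rootsOf_eq
    exact ⟨I, hS⟩
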